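/- Let $\mu_0,M_0,f>0$. Let $\mathbb H$ be the quaternions, and let $\Sigma^0=\{(z,w)\in\mathbb H\times\mathbb H\setminus\{(0,0)\}:\ \mathrm{Re}(\bar z\,i\,w)=0\}$. Let $V^0=\Sigma^0/S^1$ be the quotient by the free circle action $(z,w)\mapsto(e^{i\vartheta}z,e^{i\vartheta}w)$ (the regularized phase space), a smooth 6-manifold, with projection $\pi:\Sigma^0\to V^0$ and with the symplectic form $\omega_1$ determined by $\pi^*\omega_1=\mathrm{Re}(d\bar w\wedge dz)|_{\Sigma^0}$. Where $z\neq0$, the Kustaanheimo–Stiefel map $(z,w)\mapsto\bigl(Q=\bar z\,i\,z,\ P=\frac{\bar z\,i\,w}{2|z|^2}\bigr)$ associates with a point of $V^0$ a position $Q\in\mathbb R^3\setminus\{0\}$ and a momentum $P\in\mathbb R^3$; the third axis of $\mathbb R^3$ is called vertical. Consider the Kepler Hamiltonian $T(P,Q)=\frac{\|P\|^2}{2\mu_0}-\frac{\mu_0M_0}{\|Q\|}$ and the regularized Hamiltonian $K(z,w)=\|Q\|\,(T+f)=\frac{|w|^2}{8\mu_0}+f|z|^2-\mu_0M_0$. The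 projection to the $Q$-space of the orbit of $K$ through a point with $K=\tilde f$ is the Keplerian ellipse through $(P,Q)$ for the mass $M_0+\tilde f/\mu_0$ in place of $M_0$; it is called the KS-ellipse of the point (it degenerates to a segment when $z=0$). Let $\tilde V^1\subset V^0$ be the set of points whose KS-ellipse is non-degenerate, non-circular and non-horizontal (that is, the orbital plane is not orthogonal to the vertical axis). For a state of negative energy $T$ with semi major axis $a$, eccentricity $e$ and inclination $i$, let $L=\mu_0\sqrt{M_0}\sqrt a$, $G=L\sqrt{1-e^2}$, let $u$ be the eccentric anomaly and $g$ the argument of the pericenter. Let $H$ be the vertical component of $Q\times P$ (the angular momentum vector of $(P,Q)$), and let $h$ be the longitude of the ascending node. Let $k_f(P,Q)=(P',Q)$ with $$P'=\frac{\mu_0^2M_0}{\sqrt{2\mu_0f}\;L}\,P,\qquad L=L(P',Q)=\mu_0\sqrt{M_0}\sqrt{a},$$ where $a$ is the semi major axis of the KS-ellipse of $(P,Q)$; the Keplerian ellipse of $(P',Q)$ under $T$ is then this KS-ellipse. The LCF coordinates are $$\mathcal L=\frac{\sqrt{2f}\,L^2}{\mu_0^{3/2}M_0}\circ k_f,\quad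 \delta=u\circ k_f,\quad \mathcal G=\frac{\sqrt{2f}\,L\,G}{\mu_0^{3/2}M_0}\circ k_f,\quad \gamma=g\circ k_f,\quad \mathcal H=H,\quad \zeta=h,$$ where the angles $\delta,\gamma,\zeta$ are taken modulo $2\pi$. **Proposition.** The set $\tilde V^1$ is open in $V^0$, and the LCF coordinates form a set of Darboux coordinates on $\tilde V^1$: the map $(\mathcal L,\mathcal G,\mathcal H,\delta,\gamma,\zeta)$ is a smooth diffeomorphism of $\tilde V^1$ onto an open subset of $\mathbb R^3\times(\mathbb R/2\pi\mathbb Z)^3$, and on $\tilde V^1$ $$\omega_1=d\mathcal L\wedge d\delta+d\mathcal G\wedge d\gamma+d\mathcal H\wedge d\zeta .$$ -/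

import Mathlib

open scoped ContDiff Quaternion

noncomputable section

namespace LCF

/-! ## The regularized phase space -/

/-- The quaternion unit `i`. -/
def qi : Quaternion ℝ := ⟨0, 1, 0, 0⟩

/-- The unit quaternion `e^{iϑ} = cos ϑ + i sin ϑ`. -/
def rot (ϑ : ℝ) : Quaternion ℝ := ⟨Real.cos ϑ, Real.sin ϑ, 0, 0⟩

theorem re_qi : qi.re = 0 := rfl
theorem imI_qi : qi.imI = 1 := rfl
theorem imJ_qi : qi.imJ = 0 := rfl
theorem imK_qi : qi.imK = 0 := rfl
theorem re_rot (a : ℝ) : (rot a).re = Real.cos a := rfl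
theorem imI_rot (a : ℝ) : (rot a).imI = Real.sin a := rfl
theorem imJ_rot (a : ℝ) : (rot a).imJ = 0 := rfl
theorem imK_rot (a : ℝ) : (rot a).imK = 0 := rfl

theorem rot_zero : rot 0 = 1 := by
  apply Quaternion.ext <;> simp [re_rot, imI_rot, imJ_rot, imK_rot]

theorem rot_mul (a b : ℝ) : rot a * rot b = rot (a + b) := by
  apply Quaternion.ext <;>
    simp [re_rot, imI_rot, imJ_rot, imK_rot, Real.cos_add, Real.sin_add] <;> ring

theorem star_rot_mul_qi_mul_rot (a : ℝ) : star (rot a) * qi * rot a = qi := by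
  have h := Real.sin_sq_add_cos_sq a
  apply Quaternion.ext <;>
    simp [re_rot, imI_rot, imJ_rot, imK_rot, re_qi, imI_qi, imJ_qi, imK_qi] <;> nlinarith

/-- Points of `T^*ℍ ≅ ℍ × ℍ` are pairs `(z, w)`, `w` being the fibre coordinate.
The bilinear relation is the vanishing of `BL(z, w) = Re(z̄ i w)`. -/
def BL (x : Quaternion ℝ × Quaternion ℝ) : ℝ := (star x.1 * qi * x.2).re

/-- The quadratic cone `{BL = 0}` without the origin, `Σ⁰`. -/
def SigmaZero : Set (Quaternion ℝ × Quaternion ℝ) := {x | BL x = 0 ∧ x ≠ 0}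

/-- The tangent space of `Σ⁰` at `x`: the kernel of the differential of `BL` at `x`. -/
def tangentSigma (x : Quaternion ℝ × Quaternion ℝ) : Set (Quaternion ℝ × Quaternion ℝ) :=
  {v | (star v.1 * qi * x.2 + star x.1 * qi * v.2).re = 0}

/-- The canonical symplectic form `Re(dw̄ ∧ dz)` on `T^*ℍ`, evaluated on two tangent vectors
`v = (v_z, v_w)` and `v' = (v'_z, v'_w)`. -/
def canonicalForm (v v' : Quaternion ℝ × Quaternion ℝ) : ℝ :=
  (star v.2 * v'.1 - star v'.2 * v.1).re

/-- Two points of `Σ⁰` are equivalent when they lie on the same orbit of the circle action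
`(z, w) ↦ (e^{iϑ} z, e^{iϑ} w)`, whose orbits are the characteristic leaves of `Σ⁰`. -/
instance circleOrbit : Setoid SigmaZero where
  r x y := ∃ ϑ : ℝ, y.1 = (rot ϑ * x.1.1, rot ϑ * x.1.2)
  iseqv := by
    refine ⟨fun x => ⟨0, ?_⟩, ?_, ?_⟩
    · simp [rot_zero]
    · rintro x y ⟨a, h⟩
      refine ⟨-a, ?_⟩
      rw [h]
      simp [← mul_assoc, rot_mul, rot_zero]
    · rintro x y z ⟨a, h⟩ ⟨b, h'⟩
      refine ⟨b + a, ?_⟩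
      rw [h', h]
      simp [← mul_assoc, rot_mul]

/-- The regularized phase space `V⁰ = Σ⁰ / S¹`, with the quotient topology. -/
def VZero : Type := Quotient circleOrbit

instance : TopologicalSpace VZero := inferInstanceAs (TopologicalSpace (Quotient circleOrbit))

/-- The projection `π : Σ⁰ → V⁰`. -/
def proj (x : SigmaZero) : VZero := Quotient.mk circleOrbit x

/-! ## The Kustaanheimo-Stiefel map -/

/-- The vector of `ℝ³` given by the imaginary part of a quaternion. -/
def imVec (q : Quaternion ℝ) : Fin 3 → ℝ := ![q.imI, q.imJ, q.imK]

/-- A physical state `(Q, P)`: position `Q` and momentum `P` in `ℝ³`. -/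
abbrev State : Type := (Fin 3 → ℝ) × (Fin 3 → ℝ)

/-- The Kustaanheimo-Stiefel map `(z, w) ↦ (Q = z̄ i z, P = z̄ i w / (2 |z|²))`. On `Σ⁰` both
quaternions are purely imaginary and hence vectors of `ℝ³`. It is meaningful where `z ≠ 0`. -/
def KS (x : Quaternion ℝ × Quaternion ℝ) : State :=
  (imVec (star x.1 * qi * x.1), imVec ((1 / (2 * ‖x.1‖ ^ 2)) • (star x.1 * qi * x.2)))

theorem norm_rot (a : ℝ) : ‖rot a‖ = 1 := by
  have h : ‖rot a‖ * ‖rot a‖ = 1 := by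
    rw [← Quaternion.normSq_eq_norm_mul_self]
    simp only [Quaternion.normSq_def', re_rot, imI_rot, imJ_rot, imK_rot]
    nlinarith [Real.sin_sq_add_cos_sq a]
  nlinarith [norm_nonneg (rot a)]

/-- The map induced on `V⁰` by the Kustaanheimo-Stiefel map. -/
def VZero.state (p : VZero) : State :=
  Quotient.lift (fun x : SigmaZero => KS x.1) (by
    rintro x y ⟨a, h⟩
    have key : ∀ u v : Quaternion ℝ,
        star (rot a * u) * qi * (rot a * v) = star u * qi * v := by
      intro u v
      rw [star_mul]
      calc star u * star (rot a) * qi * (rot a * v)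
          = star u * (star (rot a) * qi * rot a) * v := by simp only [mul_assoc]
        _ = star u * qi * v := by rw [star_rot_mul_qi_mul_rot]
    simp only [KS, h, key, norm_mul, norm_rot, one_mul]) p

/-! ## The Kepler problem and Delaunay elements

`μ` and `M` are the mass parameters. -/

/-- The Euclidean norm on `ℝ³`. -/
def len (v : Fin 3 → ℝ) : ℝ := √(v ⬝ᵥ v)

/-- The Kepler Hamiltonian `T = ‖P‖² / (2μ) - μ M / ‖Q‖`. -/
def keplerT (μ M : ℝ) (s : State) : ℝ := len s.2 ^ 2 / (2 * μ) - μ * M / len s.1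

/-- The angular momentum vector `Q × P`. -/
def angMom (s : State) : Fin 3 → ℝ := crossProduct s.1 s.2

/-- The semi major axis of the Keplerian ellipse through `s`, given by `T = - μ M / (2 a)`. -/
def semiMajor (μ M : ℝ) (s : State) : ℝ := -(μ * M) / (2 * keplerT μ M s)

/-- The eccentricity (Laplace-Runge-Lenz) vector of the Keplerian orbit through `s`: it points from
the focus `0` towards the pericenter, and its length is the eccentricity. -/
def eccVec (μ M : ℝ) (s : State) : Fin 3 → ℝ :=
  (1 / (μ ^ 2 * M)) • crossProduct s.2 (angMom s) - (1 / len s.1) • s.1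

/-- The eccentricity. -/
def ecc (μ M : ℝ) (s : State) : ℝ := len (eccVec μ M s)

/-- The vertical unit vector. -/
def vertical : Fin 3 → ℝ := ![0, 0, 1]

/-- The vector pointing towards the ascending node of the oriented orbital plane on the horizontal
plane; it vanishes exactly when the angular momentum is vertical or zero. -/
def nodeVec (s : State) : Fin 3 → ℝ := crossProduct vertical (angMom s)

/-- The polar angle, modulo `2π`, of the vector `(x, y) ≠ 0` of the plane. -/
def polarAngle (x y : ℝ) : Real.Angle := ((Complex.arg ⟨x, y⟩ : ℝ) : Real.Angle)

/-- `L = μ √M √a`, the circular angular momentum. -/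
def delL (μ M : ℝ) (s : State) : ℝ := μ * √M * √(semiMajor μ M s)

/-- `G = L √(1 - e²)`, the angular momentum. -/
def delG (μ M : ℝ) (s : State) : ℝ := delL μ M s * √(1 - ecc μ M s ^ 2)

/-- `H`, the vertical component of the angular momentum. -/
def delH (s : State) : ℝ := angMom s 2

/-- The eccentric anomaly `u`: the point on the ellipse satisfies
`e cos u = 1 - ‖Q‖ / a` and `e sin u = Q · P / L`. -/
def eccAnomaly (μ M : ℝ) (s : State) : Real.Angle :=
  polarAngle (1 - len s.1 / semiMajor μ M s) ((s.1 ⬝ᵥ s.2) / delL μ M s)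

/-- The argument of the pericenter `g`: the angle from the ascending node to the pericenter, in the
orbital plane oriented by the angular momentum. -/
def delg (μ M : ℝ) (s : State) : Real.Angle :=
  polarAngle (len (angMom s) * (nodeVec s ⬝ᵥ eccVec μ M s))
    (crossProduct (angMom s) (nodeVec s) ⬝ᵥ eccVec μ M s)

/-- The longitude of the ascending node `h`, measured from the first axis. -/
def delh (s : State) : Real.Angle := polarAngle (nodeVec s 0) (nodeVec s 1)

/-! ## KS-ellipses, the map `k_f` and the LCF coordinates -/

/-- The regularized energy `f̃ = ‖Q‖ (T + f)`; it is the value at `(z, w)` of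
`K = |w|² / (8μ) + f |z|² - μ M`. -/
def regEnergy (μ M f : ℝ) (s : State) : ℝ := len s.1 * (keplerT μ M s + f)

/-- The mass for which the KS-ellipse through `s` (the projection to the physical space of the orbit
of the regularized Kepler flow) is a Keplerian ellipse: `M + f̃ / μ`. -/
def ksMass (μ M f : ℝ) (s : State) : ℝ := M + regEnergy μ M f s / μ

/-- The semi major axis of the KS-ellipse through `s`. -/
def ksSemiMajor (μ M f : ℝ) (s : State) : ℝ := semiMajor μ (ksMass μ M f s) s

/-- The map `k_f : (Q, P) ↦ (Q, P' = μ² M P / (√(2 μ f) L))`, where `L = μ √M √a` and `a` is the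
semi major axis of the KS-ellipse of `(Q, P)`. -/
def kf (μ M f : ℝ) (s : State) : State :=
  (s.1, (μ ^ 2 * M / (√(2 * μ * f) * (μ * √M * √(ksSemiMajor μ M f s)))) • s.2)

/-- The map `k_f` does not change the semi major axis: the Keplerian ellipse through `k_f(s)` for the
mass `M` has the semi major axis of the KS-ellipse through `s`. -/
theorem semiMajor_kf (μ M f : ℝ) (hμ : 0 < μ) (hM : 0 < M) (hf : 0 < f) (s : State)
    (hs : s.1 ≠ 0) : semiMajor μ M (kf μ M f s) = ksSemiMajor μ M f s := by
  have hr : 0 < len s.1 := by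
    refine Real.sqrt_pos.mpr (lt_of_le_of_ne ?_ ?_)
    · exact Finset.sum_nonneg fun i _ => mul_self_nonneg _
    · exact fun h => hs (dotProduct_self_eq_zero.mp h.symm)
  have hsmul : ∀ c : ℝ, len (c • s.2) ^ 2 = c ^ 2 * len s.2 ^ 2 := by
    intro c
    have h0 : ∀ v : Fin 3 → ℝ, len v ^ 2 = v ⬝ᵥ v := fun v =>
      Real.sq_sqrt (Finset.sum_nonneg fun i _ => mul_self_nonneg _)
    rw [h0, h0, smul_dotProduct, dotProduct_smul, smul_eq_mul, smul_eq_mul]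
    ring
  set r := len s.1 with hrdef
  set p := len s.2 ^ 2 with hp
  have hp0 : 0 ≤ p := sq_nonneg _
  set D := p / (2 * μ) + f with hD
  have hDpos : 0 < D := by positivity
  have hmass : ksMass μ M f s = r * D / μ := by
    simp only [ksMass, regEnergy, keplerT, ← hrdef, ← hp]
    field_simp
    rw [hD]
    field_simp
    ring
  have ha : ksSemiMajor μ M f s = r * D / (2 * f) := by
    have hT : keplerT μ (ksMass μ M f s) s = -f := by
      rw [hmass]
      simp only [keplerT, ← hrdef, ← hp]
      rw [hD]
      field_simp
      ring
    rw [ksSemiMajor, semiMajor, hT, hmass]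
    field_simp
  have ha0 : 0 ≤ ksSemiMajor μ M f s := by rw [ha]; positivity
  have hc : (μ ^ 2 * M / (√(2 * μ * f) * (μ * √M * √(ksSemiMajor μ M f s)))) ^ 2
      = μ * M / (r * D) := by
    rw [div_pow, mul_pow (√(2 * μ * f)), mul_pow (μ * √M), mul_pow μ,
      Real.sq_sqrt (by positivity), Real.sq_sqrt hM.le, Real.sq_sqrt ha0, ha]
    field_simp
  have hT : keplerT μ M (kf μ M f s) = -(μ * M * f / (r * D)) := by
    simp only [keplerT, kf, hsmul, hc, ← hrdef]
    have hpD : p = 2 * μ * (D - f) := by rw [hD]; field_simp; ring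
    rw [hpD]
    field_simp
    ring
  rw [semiMajor, hT, ha]
  field_simp

/-- The implicit formula `P' = μ² M P / (√(2 μ f) L(P', Q))` for `k_f(Q, P) = (Q, P')`. -/
theorem kf_eq (μ M f : ℝ) (hμ : 0 < μ) (hM : 0 < M) (hf : 0 < f) (s : State) (hs : s.1 ≠ 0) :
    kf μ M f s = (s.1, (μ ^ 2 * M / (√(2 * μ * f) * delL μ M (kf μ M f s))) • s.2) := by
  rw [delL, semiMajor_kf μ M f hμ hM hf s hs, kf]

/-- `Ṽ¹`: the KS-ellipse is non-degenerate, non-circular and non-horizontal. (Points with `z = 0` lie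
on degenerate KS-ellipses.) -/
def VTilde (μ M f : ℝ) : Set VZero :=
  {p | p.state.1 ≠ 0 ∧ angMom p.state ≠ 0 ∧ ecc μ (ksMass μ M f p.state) p.state ≠ 0 ∧
    nodeVec p.state ≠ 0}

/-- The LCF coordinates, with `(𝓛, 𝓖, 𝓗)` as first and `(δ, γ, ζ)` as second component. -/
def coords (μ M f : ℝ) (p : VZero) : (Fin 3 → ℝ) × (Fin 3 → Real.Angle) :=
  (![√(2 * f) * delL μ M (kf μ M f p.state) ^ 2 / (μ ^ (3 / 2 : ℝ) * M),
     √(2 * f) * delL μ M (kf μ M f p.state) * delG μ M (kf μ M f p.state) /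
       (μ ^ (3 / 2 : ℝ) * M),
     delH p.state],
   ![eccAnomaly μ M (kf μ M f p.state), delg μ M (kf μ M f p.state), delh p.state])

/-! ## Darboux coordinates on open subsets of the reduced space

`V⁰` carries the smooth structure for which `π : Σ⁰ → V⁰` is a submersion, and the symplectic form
`ω₁` with `π^* ω₁ = Re(dw̄ ∧ dz)` on `Σ⁰`. A function on an open subset of `V⁰` is smooth if and only
if its composition with `π` is, that is, locally the restriction of a smooth function on `ℍ × ℍ`;
a map into `V⁰` is smooth if and only if it has local smooth lifts to `Σ⁰`. -/

/-- Componentwise projection `ℝ³ → (ℝ / 2πℤ)³`. -/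
def toAngles (t : Fin 3 → ℝ) : Fin 3 → Real.Angle := fun k => ((t k : ℝ) : Real.Angle)

/-- `Φ` is a smooth map on `U`, and with `Φ = (A, θ)` it satisfies `ω₁ = ∑ dA_k ∧ dθ_k` on `U`. -/
def IsSymplecticOn (U : Set VZero) (Φ : VZero → (Fin 3 → ℝ) × (Fin 3 → Real.Angle)) : Prop :=
  ∀ x : SigmaZero, proj x ∈ U →
    ∃ N : Set (Quaternion ℝ × Quaternion ℝ), IsOpen N ∧ x.1 ∈ N ∧
      ∃ A θ : Quaternion ℝ × Quaternion ℝ → (Fin 3 → ℝ),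
        ContDiffOn ℝ ∞ A N ∧ ContDiffOn ℝ ∞ θ N ∧
        (∀ y : SigmaZero, y.1 ∈ N → Φ (proj y) = (A y.1, toAngles (θ y.1))) ∧
        ∀ y : SigmaZero, y.1 ∈ N → ∀ v ∈ tangentSigma y.1, ∀ v' ∈ tangentSigma y.1,
          canonicalForm v v' =
            ∑ k : Fin 3, (fderiv ℝ A y.1 v k * fderiv ℝ θ y.1 v' k -
              fderiv ℝ A y.1 v' k * fderiv ℝ θ y.1 v k)

/-- The inverse of the injective map `Φ` on `U` is smooth. -/
def HasSmoothInverseOn (U : Set VZero) (Φ : VZero → (Fin 3 → ℝ) × (Fin 3 → Real.Angle)) : Prop :=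
  ∀ a t : Fin 3 → ℝ, (a, toAngles t) ∈ Φ '' U →
    ∃ W : Set ((Fin 3 → ℝ) × (Fin 3 → ℝ)), IsOpen W ∧ (a, t) ∈ W ∧
      ∃ σ : (Fin 3 → ℝ) × (Fin 3 → ℝ) → Quaternion ℝ × Quaternion ℝ,
        ContDiffOn ℝ ∞ σ W ∧
        ∀ q ∈ W, ∃ h : σ q ∈ SigmaZero,
          proj ⟨σ q, h⟩ ∈ U ∧ Φ (proj ⟨σ q, h⟩) = (q.1, toAngles q.2)

/-- `Φ = (A, θ)` is a system of Darboux coordinates on the open set `U ⊆ V⁰`, with angles `θ`: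
a diffeomorphism of `U` onto an open subset of `ℝ³ × (ℝ / 2πℤ)³` with `ω₁ = ∑ dA_k ∧ dθ_k`. -/
structure IsDarbouxCoordinates (U : Set VZero)
    (Φ : VZero → (Fin 3 → ℝ) × (Fin 3 → Real.Angle)) : Prop where
  isOpen : IsOpen U
  isOpenEmbedding : Topology.IsOpenEmbedding (U.domRestrict Φ)
  symplectic : IsSymplecticOn U Φ
  smooth_inverse : HasSmoothInverseOn U Φ

end LCF

end

/-!
The LCF coordinates depend on the masses and on `f` only through `k = √(2 μ f)` once the rescaling
`k_f` is carried out: with `r = ‖Q‖` and `C = Q × P` the actions are `𝓛 = r (‖P‖² + k²) / (2 k)`,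
`𝓖 = ‖C‖` and `𝓗 = C₃`, the eccentricity vector of the KS-ellipse is
`E = P × C / (k 𝓛) - Q / r`, and `δ`, `γ`, `ζ` are polar angles of explicit vectors built from `Q`,
`P`, `C`, `E` (`coords_eq`). Write `stateCoords` for this map on states. It is injective where `Q`,
`C`, `E` and the node are nonzero: the coordinates give `C`, then `E`, then `Q`, then `P`
(`stateCoords_injOn`). Moreover a state determines a point of `V⁰`, since a unit quaternion that
commutes with `i` is some `e^{iϑ}` (`proj_eq_of_KS_eq`).

The inverse is explicit. The Kustaanheimo-Stiefel map turns the regularized Kepler flow into a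
harmonic oscillator, and one can write `z = z₀ q`, `w = w₀ q`. Here the planar spinor
`z₀ = A cos (δ/2) - B sin (δ/2) k` traces an ellipse whose square is the Keplerian ellipse, `w₀` is
proportional to `∂z₀/∂δ`, and the unit quaternion `q = e^{-kγ/2} e^{-iι/2} e^{-kζ/2}` places the
ellipse in space, `ι` being the inclination. All ingredients are smooth functions of actions and
angles on the domain `0 < 𝓖 < 𝓛`, `|𝓗| < 𝓖`, so this is a globally defined smooth section
`actionAngleSection` with values in `Σ⁰`, and it inverts the coordinates
(`stateCoords_actionAngleSection`).

The symplectic form is computed on the section, where it is a short product rule: the oscillator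
contributes `d𝓛 ∧ dδ`, and the motion of the orbital frame, paired with the angular momentum, gives
the other two terms (`canonicalForm_fderiv_actionAngleSection`). To transport this identity to an
arbitrary point of `Σ⁰`, one uses that the Kustaanheimo-Stiefel map pulls `dP ∧ dQ` back to the
canonical form on `Σ⁰` (`canonicalForm_eq_KS`): for smooth local representatives `F = (A, θ)` of the
coordinates as functions of the state, which exist because the polar angle of a nonzero vector has
them, the composite `KS ∘ actionAngleSection ∘ F ∘ KS` agrees with `KS` near every point with
coordinates (`canonicalForm_eq_of_representatives`). Continuity and openness of the coordinate map
follow from the local representatives and from the section.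
-/

noncomputable section

namespace LCF

/-! ### Vectors of `ℝ³` and polar angles -/

theorem len_sq (v : Fin 3 → ℝ) : len v ^ 2 = v ⬝ᵥ v :=
  Real.sq_sqrt (Finset.sum_nonneg fun _ _ => mul_self_nonneg _)

theorem len_nonneg (v : Fin 3 → ℝ) : 0 ≤ len v := Real.sqrt_nonneg _

theorem len_ne_zero {v : Fin 3 → ℝ} (hv : v ≠ 0) : len v ≠ 0 := by
  intro h
  have := len_sq v
  rw [h] at this
  exact hv (dotProduct_self_eq_zero.mp (by linarith))

theorem len_pos {v : Fin 3 → ℝ} (hv : v ≠ 0) : 0 < len v :=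
  lt_of_le_of_ne (len_nonneg v) (len_ne_zero hv).symm

theorem len_smul {c : ℝ} (hc : 0 ≤ c) (v : Fin 3 → ℝ) : len (c • v) = c * len v := by
  have h : (c • v) ⬝ᵥ (c • v) = c ^ 2 * (v ⬝ᵥ v) := by
    rw [smul_dotProduct, dotProduct_smul, smul_eq_mul, smul_eq_mul]; ring
  rw [len, h, Real.sqrt_mul (sq_nonneg c), Real.sqrt_sq hc, len]

theorem dotProduct_self_pos {v : Fin 3 → ℝ} (hv : v ≠ 0) : 0 < v ⬝ᵥ v := by
  rw [← len_sq]; exact pow_pos (len_pos hv) 2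

theorem polarAngle_mul {c : ℝ} (hc : 0 < c) (x y : ℝ) :
    polarAngle (c * x) (c * y) = polarAngle x y := by
  have h : (⟨c * x, c * y⟩ : ℂ) = (c : ℂ) * ⟨x, y⟩ := by
    apply Complex.ext <;> simp
  rw [polarAngle, polarAngle, h, Complex.arg_real_mul _ hc]

theorem polarAngle_cos_sin {c : ℝ} (hc : 0 < c) (t : ℝ) :
    polarAngle (c * Real.cos t) (c * Real.sin t) = (t : Real.Angle) := by
  have h := Complex.arg_mul_cos_add_sin_mul_I_coe_angle hc (t : Real.Angle)
  rw [Real.Angle.cos_coe, Real.Angle.sin_coe] at h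
  have hc' : (c : ℂ) * (Real.cos t + Real.sin t * Complex.I)
      = ⟨c * Real.cos t, c * Real.sin t⟩ := by
    apply Complex.ext <;> simp [-Complex.ofReal_cos, -Complex.ofReal_sin]
  rw [← h, polarAngle, hc']

/-- A vector of the plane is determined by its polar angle and its length. -/
theorem eq_of_polarAngle_eq {x y x' y' : ℝ} (h : polarAngle x y = polarAngle x' y')
    (hn : x ^ 2 + y ^ 2 = x' ^ 2 + y' ^ 2) : x = x' ∧ y = y' := by
  have h' := Complex.arg_coe_angle_eq_iff.mp h
  have hnorm : ‖(⟨x, y⟩ : ℂ)‖ = ‖(⟨x', y'⟩ : ℂ)‖ := by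
    rw [Complex.norm_def, Complex.norm_def, Complex.normSq_mk, Complex.normSq_mk]
    congr 1
    linarith
  have := Complex.ext_norm_arg hnorm h'
  exact ⟨congrArg Complex.re this, congrArg Complex.im this⟩

/-! ### The coordinates as functions of the physical state -/

/-- The action `𝓛` as a function of the state: `‖Q‖ (‖P‖² + k²) / (2 k)`, where `k = √(2 μ f)`. -/
def redAction (k : ℝ) (s : State) : ℝ := len s.1 * (len s.2 ^ 2 + k ^ 2) / (2 * k)

/-- The eccentricity vector of the KS-ellipse through `s`, where `k = √(2 μ f)`. -/
def redEcc (k : ℝ) (s : State) : Fin 3 → ℝ :=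
  (1 / (k * redAction k s)) • crossProduct s.2 (angMom s) - (1 / len s.1) • s.1

/-- The LCF coordinates as functions of the state, freed of the rescaling `k_f`. The masses and the
energy `f` enter only through `k = √(2 μ f)`. -/
def stateCoords (k : ℝ) (s : State) : (Fin 3 → ℝ) × (Fin 3 → Real.Angle) :=
  (![redAction k s, len (angMom s), angMom s 2],
   ![polarAngle (redAction k s - k * len s.1) (s.1 ⬝ᵥ s.2),
     polarAngle (len (angMom s) * (nodeVec s ⬝ᵥ redEcc k s))
      (crossProduct (angMom s) (nodeVec s) ⬝ᵥ redEcc k s),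
     polarAngle (nodeVec s 0) (nodeVec s 1)])

/-- The states whose KS-ellipse is non-degenerate, non-circular and non-horizontal. -/
def goodStates (k : ℝ) : Set State :=
  {s | s.1 ≠ 0 ∧ angMom s ≠ 0 ∧ redEcc k s ≠ 0 ∧ nodeVec s ≠ 0}

theorem redAction_pos {k : ℝ} (hk : 0 < k) {s : State} (hs : s.1 ≠ 0) : 0 < redAction k s := by
  have := len_pos hs
  unfold redAction
  positivity

theorem angMom_smul (s : State) (c : ℝ) : angMom (s.1, c • s.2) = c • angMom s := by
  simp [angMom]

theorem nodeVec_smul (s : State) (c : ℝ) : nodeVec (s.1, c • s.2) = c • nodeVec s := by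
  simp [nodeVec, angMom_smul]

theorem angMom_dot_position (s : State) : s.1 ⬝ᵥ angMom s = 0 := by
  rw [angMom, dot_self_cross]

theorem angMom_dot_momentum (s : State) : s.2 ⬝ᵥ angMom s = 0 := by
  rw [angMom, dot_cross_self]

theorem redEcc_dot_angMom (k : ℝ) (s : State) : redEcc k s ⬝ᵥ angMom s = 0 := by
  rw [dotProduct_comm, redEcc, dotProduct_sub, dotProduct_smul, dotProduct_smul, dot_cross_self,
    dotProduct_comm, angMom_dot_position]
  simp

/-- Lagrange's identity `|Q|² |P|² = (Q · P)² + |Q × P|²`. -/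
theorem lagrange_identity (s : State) :
    len s.1 ^ 2 * len s.2 ^ 2 = (s.1 ⬝ᵥ s.2) ^ 2 + len (angMom s) ^ 2 := by
  simp only [len_sq, angMom, cross_dot_cross]
  rw [dotProduct_comm s.2 s.1]; ring

/-- `e² = 1 - 𝓖² / 𝓛²`. -/
theorem redEcc_sq {k : ℝ} (hk : 0 < k) {s : State} (hs : s.1 ≠ 0) :
    len (redEcc k s) ^ 2 = 1 - len (angMom s) ^ 2 / redAction k s ^ 2 := by
  have hr := len_pos hs
  have hL := redAction_pos hk hs
  have h1 : crossProduct s.2 (angMom s) ⬝ᵥ crossProduct s.2 (angMom s)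
      = len s.2 ^ 2 * len (angMom s) ^ 2 := by
    rw [cross_dot_cross, angMom_dot_momentum, len_sq, len_sq]; ring
  have h2 : s.1 ⬝ᵥ crossProduct s.2 (angMom s) = len (angMom s) ^ 2 := by
    rw [triple_product_permutation, triple_product_permutation, len_sq]; rfl
  have h3 : len s.2 ^ 2 = 2 * k * redAction k s / len s.1 - k ^ 2 := by
    rw [redAction]; field_simp; ring
  rw [len_sq, redEcc, sub_dotProduct, dotProduct_sub, dotProduct_sub]
  simp only [smul_dotProduct, dotProduct_smul, smul_eq_mul]
  rw [dotProduct_comm _ s.1, h1, h2, ← len_sq s.1, h3]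
  field_simp
  ring

/-- The eccentric anomaly is the polar angle of a vector of length `e 𝓛`. -/
theorem eccAnomaly_sq {k : ℝ} (hk : 0 < k) (s : State) :
    (redAction k s - k * len s.1) ^ 2 + (s.1 ⬝ᵥ s.2) ^ 2
      = redAction k s ^ 2 - len (angMom s) ^ 2 := by
  have h := lagrange_identity s
  have h3 : len s.1 * len s.2 ^ 2 = 2 * k * redAction k s - k ^ 2 * len s.1 := by
    rw [redAction]; field_simp; ring
  linear_combination (-1 : ℝ) * h + len s.1 * h3

theorem nodeVec_apply (s : State) : nodeVec s = ![-angMom s 1, angMom s 0, 0] := by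
  simp [nodeVec, vertical, cross_apply]

theorem nodeVec_sq (s : State) : nodeVec s 0 ^ 2 + nodeVec s 1 ^ 2
    = len (angMom s) ^ 2 - angMom s 2 ^ 2 := by
  simp only [nodeVec_apply, len_sq, Matrix.vec3_dotProduct]
  simp
  ring

/-- The argument of the pericenter is the polar angle of a vector of length `|C|² |n| e`, because
the eccentricity vector lies in the orbital plane. -/
theorem delg_sq (s : State) {E : Fin 3 → ℝ} (hE : E ⬝ᵥ angMom s = 0) :
    (len (angMom s) * (nodeVec s ⬝ᵥ E)) ^ 2 + (crossProduct (angMom s) (nodeVec s) ⬝ᵥ E) ^ 2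
      = len (angMom s) ^ 2 * (len (angMom s) ^ 2 - angMom s 2 ^ 2) * len E ^ 2 := by
  rw [mul_pow]
  simp only [nodeVec_apply, len_sq, Matrix.vec3_dotProduct, cross_apply] at hE ⊢
  generalize angMom s = C at *
  simp
  linear_combination (-(C 0 ^ 2 + C 1 ^ 2) * (E 0 * C 0 + E 1 * C 1 + E 2 * C 2)) * hE

/-! ### Carrying out the rescaling `k_f` -/

/-- The mass and the semi major axis `𝓛 / k` of the KS-ellipse, where `k = √(2 μ f)`. The energy of
the state for the mass of the KS-ellipse is `-f`. -/
theorem ksSemiMajor_eq {μ M f : ℝ} (hμ : 0 < μ) (hf : 0 < f) {s : State} (hs : s.1 ≠ 0) :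
    μ ^ 2 * ksMass μ M f s = √(2 * μ * f) * redAction (√(2 * μ * f)) s ∧
      ksSemiMajor μ M f s = redAction (√(2 * μ * f)) s / √(2 * μ * f) := by
  have hr := len_pos hs
  have hk : 0 < √(2 * μ * f) := Real.sqrt_pos.mpr (by positivity)
  have hk2 : √(2 * μ * f) ^ 2 = 2 * μ * f := Real.sq_sqrt (by positivity)
  have hL := redAction_pos hk hs
  set k := √(2 * μ * f)
  have hmass : μ ^ 2 * ksMass μ M f s = k * redAction k s := by
    simp only [ksMass, regEnergy, keplerT, redAction, hk2]
    field_simp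
    ring
  have hmass' : μ * ksMass μ M f s = k * redAction k s / μ := by rw [← hmass]; field_simp
  have hT : keplerT μ (ksMass μ M f s) s = -f := by
    rw [keplerT, hmass', redAction]
    field_simp
    rw [hk2]; ring
  refine ⟨hmass, ?_⟩
  rw [ksSemiMajor, semiMajor, hT, hmass']
  field_simp
  rw [hk2]; ring

theorem eccVec_ksMass {μ M f : ℝ} (hμ : 0 < μ) (hf : 0 < f) {s : State} (hs : s.1 ≠ 0) :
    eccVec μ (ksMass μ M f s) s = redEcc (√(2 * μ * f)) s := by
  rw [eccVec, redEcc, ← (ksSemiMajor_eq (M := M) hμ hf hs).1]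

/-- The map `k_f` turns the KS-ellipse into a Keplerian ellipse with the same eccentricity vector,
and the LCF coordinates are `stateCoords`. -/
theorem coords_eq {μ M f : ℝ} (hμ : 0 < μ) (hM : 0 < M) (hf : 0 < f) {p : VZero}
    (hs : p.state.1 ≠ 0) : coords μ M f p = stateCoords (√(2 * μ * f)) p.state := by
  unfold coords stateCoords
  generalize p.state = s at *
  have ha := (ksSemiMajor_eq (M := M) hμ hf hs).2
  have hr := len_pos hs
  have hk : 0 < √(2 * μ * f) := Real.sqrt_pos.mpr (by positivity)
  have hk2 : √(2 * μ * f) ^ 2 = 2 * μ * f := Real.sq_sqrt (by positivity)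
  have hL := redAction_pos hk hs
  have hecc := redEcc_sq hk hs
  have hkf : √(2 * f) / μ ^ (3 / 2 : ℝ) * μ ^ 2 = √(2 * μ * f) := by
    have h1 : μ ^ (3 / 2 : ℝ) = μ * √μ := by
      rw [Real.sqrt_eq_rpow, show (3 / 2 : ℝ) = 1 + 1 / 2 by norm_num, Real.rpow_add hμ,
        Real.rpow_one]
    have h2 : √(2 * μ * f) = √(2 * f) * √μ := by
      rw [← Real.sqrt_mul (by positivity)]; congr 1; ring
    have h3 : √μ ^ 2 = μ := Real.sq_sqrt hμ.le
    have h4 : 0 < √μ := Real.sqrt_pos.mpr hμ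
    rw [h1, h2, div_mul_eq_mul_div, div_eq_iff (by positivity)]
    linear_combination (-√(2 * f) * μ) * h3
  set k := √(2 * μ * f) with hkdef
  set Λ := redAction k s with hΛ
  -- the circular angular momentum of the rescaled state, and the factor of `k_f`
  have hsm : semiMajor μ M (kf μ M f s) = Λ / k := by rw [semiMajor_kf μ M f hμ hM hf s hs, ha]
  have hl2 : delL μ M (kf μ M f s) ^ 2 = μ ^ 2 * M * Λ / k := by
    rw [delL, hsm, mul_pow, mul_pow, Real.sq_sqrt hM.le, Real.sq_sqrt (by positivity)]
    ring
  have hl : 0 < delL μ M (kf μ M f s) := by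
    have h1 : 0 < √M := Real.sqrt_pos.mpr hM
    have h2 : 0 < √(Λ / k) := Real.sqrt_pos.mpr (by positivity)
    rw [delL, hsm]; positivity
  have hkfs := kf_eq μ M f hμ hM hf s hs
  rw [← hkdef] at hkfs
  obtain ⟨l, hldef⟩ : ∃ l, l = delL μ M (kf μ M f s) := ⟨_, rfl⟩
  rw [← hldef] at hl2 hl hkfs
  obtain ⟨c, hc⟩ : ∃ c, c = μ ^ 2 * M / (k * l) := ⟨_, rfl⟩
  have hcpos : 0 < c := by rw [hc]; positivity
  rw [← hc] at hkfs
  have hcl : c = l / Λ := by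
    rw [hc]; field_simp; rw [hl2]; field_simp
  have hE : eccVec μ M (kf μ M f s) = redEcc k s := by
    have h1 : (1 / (μ ^ 2 * M)) * (c * c) = 1 / (k * Λ) := by
      have : c * c = l ^ 2 / Λ ^ 2 := by rw [hcl]; ring
      rw [this, hl2]; field_simp
    rw [hkfs, eccVec, angMom_smul, redEcc]
    simp only [map_smul, LinearMap.smul_apply, smul_smul]
    rw [← mul_assoc, mul_assoc, h1]
  have hG : delG μ M (kf μ M f s) = l * (len (angMom s) / Λ) := by
    rw [delG, ecc, hE, hecc, sub_sub_cancel, ← div_pow,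
      Real.sqrt_sq (div_nonneg (len_nonneg _) hL.le), ← hldef]
  refine Prod.ext ?_ ?_
  · have e1 : √(2 * f) * l ^ 2 / (μ ^ (3 / 2 : ℝ) * M) = Λ := by
      have : √(2 * f) * l ^ 2 / (μ ^ (3 / 2 : ℝ) * M)
          = (√(2 * f) / μ ^ (3 / 2 : ℝ) * μ ^ 2) * (Λ / k) := by
        rw [hl2]; field_simp
      rw [this, hkf]; field_simp
    have e2 : √(2 * f) * l * (l * (len (angMom s) / Λ)) / (μ ^ (3 / 2 : ℝ) * M)
        = len (angMom s) := by
      calc _ = (√(2 * f) * l ^ 2 / (μ ^ (3 / 2 : ℝ) * M)) * (len (angMom s) / Λ) := by ring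
        _ = _ := by rw [e1]; field_simp
    simp only [hG, ← hldef, e1, e2, delH]
  · have e1 : eccAnomaly μ M (kf μ M f s) = polarAngle (Λ - k * len s.1) (s.1 ⬝ᵥ s.2) := by
      rw [eccAnomaly, hsm, ← polarAngle_mul hL, ← hldef, hkfs, dotProduct_smul, smul_eq_mul, hcl]
      congr 1 <;> field_simp
    have e2 : delg μ M (kf μ M f s) = polarAngle (len (angMom s) * (nodeVec s ⬝ᵥ redEcc k s))
        (crossProduct (angMom s) (nodeVec s) ⬝ᵥ redEcc k s) := by
      rw [delg, hE, hkfs, angMom_smul, nodeVec_smul, len_smul hcpos.le]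
      simp only [map_smul, LinearMap.smul_apply, smul_dotProduct, smul_eq_mul]
      rw [← polarAngle_mul (mul_pos hcpos hcpos) (len (angMom s) * _)]
      congr 1 <;> ring
    simp only [e1, e2, delh]

theorem mem_VTilde_iff {μ M f : ℝ} (hμ : 0 < μ) (hf : 0 < f) (p : VZero) :
    p ∈ VTilde μ M f ↔ p.state ∈ goodStates (√(2 * μ * f)) := by
  simp only [VTilde, goodStates, Set.mem_ofPred_eq]
  refine and_congr_right fun hs => and_congr_right fun _ => and_congr_left fun _ => ?_
  rw [ecc, eccVec_ksMass hμ hf hs]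
  refine not_congr ⟨fun h => ?_, fun h => by rw [h]; simp [len]⟩
  by_contra h'
  exact len_ne_zero h' h

/-- The range of the actions: `0 < 𝓖 < 𝓛` and `|𝓗| < 𝓖`. -/
def actionDomain : Set (Fin 3 → ℝ) := {a | 0 < a 1 ∧ a 1 < a 0 ∧ |a 2| < a 1}

theorem nodeVec_sq_pos {s : State} (hn : nodeVec s ≠ 0) :
    0 < len (angMom s) ^ 2 - angMom s 2 ^ 2 := by
  have h := dotProduct_self_pos hn
  rw [← nodeVec_sq]
  have h2 : nodeVec s 2 = 0 := by simp [nodeVec_apply]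
  rw [dotProduct, Fin.sum_univ_three, h2] at h
  nlinarith [h]

theorem stateCoords_fst_mem {k : ℝ} (hk : 0 < k) {s : State} (hs : s ∈ goodStates k) :
    (stateCoords k s).1 ∈ actionDomain := by
  obtain ⟨hQ, hC, hE, hn⟩ := hs
  have hL := redAction_pos hk hQ
  have hC' := len_pos hC
  have h1 := redEcc_sq hk hQ
  have h2 := pow_pos (len_pos hE) 2
  refine ⟨hC', ?_, ?_⟩
  · change len (angMom s) < redAction k s
    rw [h1, sub_pos, div_lt_one (by positivity)] at h2
    exact lt_of_pow_lt_pow_left₀ 2 hL.le h2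
  · change |angMom s 2| < len (angMom s)
    have := nodeVec_sq_pos hn
    exact abs_lt_of_sq_lt_sq (by linarith) hC'.le

/-! ### Injectivity on states -/

/-- A vector is determined by its scalar products with `u`, `v` and `u × v`, where `u ⟂ v` are
nonzero. -/
theorem eq_of_dotProduct_eq {u v d d' : Fin 3 → ℝ} (hu : u ≠ 0) (hv : v ≠ 0) (huv : u ⬝ᵥ v = 0)
    (h1 : u ⬝ᵥ d = u ⬝ᵥ d') (h2 : v ⬝ᵥ d = v ⬝ᵥ d')
    (h3 : crossProduct u v ⬝ᵥ d = crossProduct u v ⬝ᵥ d') : d = d' := by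
  have hpos : 0 < (u ⬝ᵥ u) * (v ⬝ᵥ v) := mul_pos (dotProduct_self_pos hu) (dotProduct_self_pos hv)
  rw [← sub_eq_zero] at h1 h2 h3 ⊢
  rw [← dotProduct_sub] at h1 h2 h3
  generalize d - d' = x at *
  have h : (x ⬝ᵥ x) * ((u ⬝ᵥ u) * (v ⬝ᵥ v)) = 0 := by
    have ha : crossProduct x (crossProduct u v) = 0 := by
      rw [cross_cross_eq_smul_sub_smul', dotProduct_comm x, h1, h2]
      simp
    have hb := cross_dot_cross x (crossProduct u v) x (crossProduct u v)
    rw [ha, h3, cross_dot_cross, huv] at hb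
    simpa using hb.symm
  exact dotProduct_self_eq_zero.mp ((mul_eq_zero.mp h).resolve_right hpos.ne')

theorem position_dot_redEcc (k : ℝ) {s : State} (hs : s.1 ≠ 0) :
    redEcc k s ⬝ᵥ s.1 = len (angMom s) ^ 2 / (k * redAction k s) - len s.1 := by
  have hr := len_pos hs
  have h2 : s.1 ⬝ᵥ crossProduct s.2 (angMom s) = len (angMom s) ^ 2 := by
    rw [triple_product_permutation, triple_product_permutation, len_sq]; rfl
  rw [dotProduct_comm, redEcc, dotProduct_sub, dotProduct_smul, dotProduct_smul, h2, ← len_sq,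
    smul_eq_mul, smul_eq_mul]
  field_simp

theorem angMom_cross_redEcc_dot_position (k : ℝ) (s : State) :
    crossProduct (angMom s) (redEcc k s) ⬝ᵥ s.1
      = len (angMom s) ^ 2 * (s.1 ⬝ᵥ s.2) / (k * redAction k s) := by
  have h1 : s.1 ⬝ᵥ crossProduct (angMom s) s.1 = 0 := dot_cross_self _ _
  have h2 : s.1 ⬝ᵥ crossProduct (angMom s) (crossProduct s.2 (angMom s))
      = len (angMom s) ^ 2 * (s.1 ⬝ᵥ s.2) := by
    rw [cross_cross_eq_smul_sub_smul', dotProduct_sub, dotProduct_smul, dotProduct_smul,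
      angMom_dot_position, len_sq]
    simp
  rw [dotProduct_comm, redEcc, map_sub, map_smul, map_smul, dotProduct_sub, dotProduct_smul,
    dotProduct_smul, h1, h2, smul_eq_mul, smul_eq_mul]
  ring

theorem angMom_cross_position_dot_momentum (s : State) :
    crossProduct s.1 (angMom s) ⬝ᵥ s.2 = -len (angMom s) ^ 2 := by
  rw [dotProduct_comm, ← cross_anticomm, dotProduct_neg, triple_product_permutation, len_sq,
    ← angMom]

/-- The coordinates determine the state: one recovers the angular momentum, the eccentricity
vector, the position and finally the momentum. -/
theorem stateCoords_injOn {k : ℝ} (hk : 0 < k) : Set.InjOn (stateCoords k) (goodStates k) := by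
  rintro s ⟨hQ, hC, hE, hn⟩ s' ⟨hQ', hC', hE', hn'⟩ h
  have hfst := congrArg Prod.fst h
  have hsnd := congrArg Prod.snd h
  have hΛ : redAction k s = redAction k s' := congrFun hfst 0
  have hG : len (angMom s) = len (angMom s') := congrFun hfst 1
  have hH : angMom s 2 = angMom s' 2 := congrFun hfst 2
  have hδ : polarAngle (redAction k s - k * len s.1) (s.1 ⬝ᵥ s.2) = polarAngle _ _ :=
    congrFun hsnd 0
  have hγ : polarAngle (len (angMom s) * (nodeVec s ⬝ᵥ redEcc k s))
      (crossProduct (angMom s) (nodeVec s) ⬝ᵥ redEcc k s) = polarAngle _ _ := congrFun hsnd 1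
  have hζ : polarAngle (nodeVec s 0) (nodeVec s 1) = polarAngle _ _ := congrFun hsnd 2
  have hG0 := len_ne_zero hC'
  have hk0 := hk.ne'
  have hCeq : angMom s = angMom s' := by
    obtain ⟨h0, h1⟩ := eq_of_polarAngle_eq hζ (by rw [nodeVec_sq, nodeVec_sq, hG, hH])
    simp only [nodeVec_apply] at h0 h1
    ext i
    fin_cases i
    · exact h1
    · exact neg_injective h0
    · exact hH
  have hneq : nodeVec s = nodeVec s' := by rw [nodeVec_apply, nodeVec_apply, hCeq]
  have hEeq : redEcc k s = redEcc k s' := by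
    obtain ⟨h0, h1⟩ := eq_of_polarAngle_eq hγ (by
      rw [delg_sq s (redEcc_dot_angMom k s), delg_sq s' (redEcc_dot_angMom k s'),
        redEcc_sq hk hQ, redEcc_sq hk hQ', hG, hH, hΛ])
    rw [hCeq, hneq] at h0 h1
    refine eq_of_dotProduct_eq hC' hn' ?_ ?_ (mul_left_cancel₀ hG0 h0) h1
    · rw [nodeVec, dot_cross_self]
    · rw [dotProduct_comm, dotProduct_comm (angMom s'), redEcc_dot_angMom, ← hCeq,
        redEcc_dot_angMom]
  obtain ⟨hr, hQP⟩ := eq_of_polarAngle_eq hδ (by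
    rw [eccAnomaly_sq hk, eccAnomaly_sq hk, hΛ, hG])
  have hr : len s.1 = len s'.1 := by
    rw [hΛ] at hr
    exact mul_left_cancel₀ hk0 (by linarith)
  have hQeq : s.1 = s'.1 := by
    have hp := position_dot_redEcc k hQ
    have hp' := position_dot_redEcc k hQ'
    have hc := angMom_cross_redEcc_dot_position k s
    have hc' := angMom_cross_redEcc_dot_position k s'
    rw [hCeq, hEeq, hΛ] at hp hc
    refine eq_of_dotProduct_eq hC' hE' ?_ ?_ ?_ ?_
    · rw [dotProduct_comm, redEcc_dot_angMom]
    · rw [dotProduct_comm, dotProduct_comm (angMom s'), angMom_dot_position, ← hCeq,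
        angMom_dot_position]
    · rw [hp, hp', hr]
    · rw [hc, hc', hQP]
  refine Prod.ext hQeq ?_
  have hm := angMom_cross_position_dot_momentum s
  rw [hCeq, hQeq] at hm
  rw [hQeq] at hQP
  refine eq_of_dotProduct_eq hQ' hC' (angMom_dot_position s') hQP ?_ ?_
  · rw [dotProduct_comm, dotProduct_comm (angMom s'), angMom_dot_momentum, ← hCeq,
      angMom_dot_momentum]
  · rw [hm, angMom_cross_position_dot_momentum]

/-! ### The Kustaanheimo-Stiefel map -/

theorem normSq_components (q : Quaternion ℝ) :
    ‖q‖ ^ 2 = q.re ^ 2 + q.imI ^ 2 + q.imJ ^ 2 + q.imK ^ 2 := by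
  rw [pow_two, ← Quaternion.normSq_eq_norm_mul_self, Quaternion.normSq_def']

theorem normSq_components_pos {q : Quaternion ℝ} (hq : q ≠ 0) :
    0 < q.re ^ 2 + q.imI ^ 2 + q.imJ ^ 2 + q.imK ^ 2 := by
  rw [← normSq_components]; exact pow_pos (norm_pos_iff.mpr hq) 2

theorem star_mul_self_eq (q : Quaternion ℝ) : star q * q = ((‖q‖ ^ 2 : ℝ) : Quaternion ℝ) := by
  rw [Quaternion.star_mul_self, pow_two, Quaternion.normSq_eq_norm_mul_self]

theorem mul_star_self_eq (q : Quaternion ℝ) : q * star q = ((‖q‖ ^ 2 : ℝ) : Quaternion ℝ) := by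
  rw [Quaternion.self_mul_star, pow_two, Quaternion.normSq_eq_norm_mul_self]

theorem qi_mul_qi : qi * qi = -1 := by
  ext <;> simp [re_qi, imI_qi, imJ_qi, imK_qi]

/-- Quaternionic conjugation as a continuous linear map. -/
def starL : Quaternion ℝ →L[ℝ] Quaternion ℝ :=
  LinearMap.toContinuousLinearMap
    { toFun := star
      map_add' := star_add
      map_smul' := fun c q => by ext <;> simp }

theorem starL_apply (q : Quaternion ℝ) : starL q = star q := rfl

/-- The imaginary part as a continuous linear map. -/
def imVecL : Quaternion ℝ →L[ℝ] (Fin 3 → ℝ) :=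
  LinearMap.toContinuousLinearMap
    { toFun := imVec
      map_add' := fun p q => by ext i; fin_cases i <;> simp [imVec]
      map_smul' := fun c q => by ext i; fin_cases i <;> simp [imVec] }

theorem imVecL_apply (q : Quaternion ℝ) : imVecL q = imVec q := rfl

/-- The real part as a continuous linear map. -/
def reL : Quaternion ℝ →L[ℝ] ℝ :=
  LinearMap.toContinuousLinearMap
    { toFun := fun q => q.re
      map_add' := fun p q => by simp
      map_smul' := fun c q => by simp }

/-- The quaternion `z̄ i w / (2 |z|²)`, whose imaginary part is the momentum. -/
def momentum (x : Quaternion ℝ × Quaternion ℝ) : Quaternion ℝ :=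
  (1 / (2 * ‖x.1‖ ^ 2)) • (star x.1 * qi * x.2)

/-- The pair `(z, w)` is recovered from `z` and the momentum: `i w = 2 z P`. -/
theorem qi_mul_snd {x : Quaternion ℝ × Quaternion ℝ} (hx : x.1 ≠ 0) :
    qi * x.2 = (2 : ℝ) • (x.1 * momentum x) := by
  have h : ‖x.1‖ ≠ 0 := norm_ne_zero_iff.mpr hx
  have h1 : x.1 * (star x.1 * qi * x.2) = (‖x.1‖ ^ 2) • (qi * x.2) := by
    rw [mul_assoc, ← mul_assoc, mul_star_self_eq, ← Quaternion.coe_mul_eq_smul]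
  rw [momentum, mul_smul_comm, h1, smul_smul, smul_smul]
  have : 2 * (1 / (2 * ‖x.1‖ ^ 2) * ‖x.1‖ ^ 2) = 1 := by field_simp
  rw [← mul_assoc] at this
  rw [this, one_smul]

theorem momentum_re {x : Quaternion ℝ × Quaternion ℝ} (hx : BL x = 0) : (momentum x).re = 0 := by
  rw [BL] at hx
  rw [momentum, Quaternion.re_smul, hx, smul_zero]

theorem contDiffOn_momentum : ContDiffOn ℝ ∞ momentum {x | x.1 ≠ 0} := by
  have h1 : ContDiff ℝ ∞ fun x : Quaternion ℝ × Quaternion ℝ => star x.1 :=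
    starL.contDiff.comp contDiff_fst
  have h2 : ContDiff ℝ ∞ fun x : Quaternion ℝ × Quaternion ℝ => star x.1 * qi * x.2 :=
    (h1.mul contDiff_const).mul contDiff_snd
  have h3 : ContDiff ℝ ∞ fun x : Quaternion ℝ × Quaternion ℝ => 2 * ‖x.1‖ ^ 2 :=
    contDiff_const.mul (contDiff_fst.norm_sq ℝ)
  refine ContDiffOn.smul (contDiffOn_const.div h3.contDiffOn ?_) h2.contDiffOn
  intro x hx
  have : ‖x.1‖ ≠ 0 := norm_ne_zero_iff.mpr hx
  positivity

theorem isOpen_fst_ne_zero : IsOpen {x : Quaternion ℝ × Quaternion ℝ | x.1 ≠ 0} :=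
  isOpen_ne_fun continuous_fst continuous_const

theorem KS_fst_eq_zero_iff {x : Quaternion ℝ × Quaternion ℝ} : (KS x).1 = 0 ↔ x.1 = 0 := by
  constructor
  · intro h
    by_contra hx
    have hp := normSq_components_pos hx
    have h0 := congrFun h 0
    have h1 := congrFun h 1
    have h2 := congrFun h 2
    simp [KS, imVec, re_qi, imI_qi, imJ_qi, imK_qi] at h0 h1 h2
    set a := x.1.re; set b := x.1.imI; set c := x.1.imJ; set d := x.1.imK
    have : (a ^ 2 + b ^ 2 + c ^ 2 + d ^ 2) ^ 2 = 0 := by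
      have e0 : a ^ 2 + b ^ 2 - c ^ 2 - d ^ 2 = 0 := by linarith
      have e1 : b * c - a * d = 0 := by linarith
      have e2 : b * d + a * c = 0 := by linarith
      linear_combination (a ^ 2 + b ^ 2 - c ^ 2 - d ^ 2) * e0 + 4 * (b * c - a * d) * e1
        + 4 * (b * d + a * c) * e2
    exact (pow_pos hp 2).ne' this
  · intro h
    ext i
    fin_cases i <;> simp [KS, imVec, h]

theorem contDiff_KS_fst :
    ContDiff ℝ ∞ fun x : Quaternion ℝ × Quaternion ℝ => (KS x).1 := by
  have h1 : ContDiff ℝ ∞ fun x : Quaternion ℝ × Quaternion ℝ => star x.1 :=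
    starL.contDiff.comp contDiff_fst
  exact imVecL.contDiff.comp ((h1.mul contDiff_const).mul contDiff_fst)

theorem contDiffOn_KS : ContDiffOn ℝ ∞ KS {x | x.1 ≠ 0} :=
  contDiff_KS_fst.contDiffOn.prodMk (imVecL.contDiff.comp_contDiffOn contDiffOn_momentum)

/-- The fibres of the Kustaanheimo-Stiefel map over nonzero positions are circle orbits. -/
theorem proj_eq_of_KS_eq {x y : SigmaZero} (hx : x.1.1 ≠ 0) (h : KS x.1 = KS y.1) :
    proj x = proj y := by
  have hy : y.1.1 ≠ 0 := fun hy => hx (KS_fst_eq_zero_iff.mp (h ▸ KS_fst_eq_zero_iff.mpr hy))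
  have hre : ∀ q : Quaternion ℝ, (star q * qi * q).re = 0 := fun q => by
    simp [re_qi, imI_qi, imJ_qi, imK_qi]; ring
  have hext : ∀ p q : Quaternion ℝ, p.re = 0 → q.re = 0 → imVec p = imVec q → p = q := by
    intro p q hp hq hpq
    exact Quaternion.ext _ _ (hp.trans hq.symm) (congrFun hpq 0) (congrFun hpq 1)
      (congrFun hpq 2)
  have hQ : star x.1.1 * qi * x.1.1 = star y.1.1 * qi * y.1.1 :=
    hext _ _ (hre _) (hre _) (congrArg Prod.fst h)
  have hP : momentum x.1 = momentum y.1 :=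
    hext _ _ (momentum_re x.2.1) (momentum_re y.2.1) (congrArg Prod.snd h)
  -- the positions have equal lengths, and these are the squared norms of the spinors
  have hn : ‖x.1.1‖ = ‖y.1.1‖ := by
    have hqi : ‖qi‖ = 1 := by
      have := normSq_components qi
      simp only [re_qi, imI_qi, imJ_qi, imK_qi] at this
      have h0 := norm_nonneg qi
      nlinarith
    have := congrArg norm hQ
    simp only [norm_mul, Quaternion.norm_star, hqi, mul_one] at this
    exact (mul_self_inj (norm_nonneg _) (norm_nonneg _)).mp this
  have hn0 : ‖x.1.1‖ ≠ 0 := norm_ne_zero_iff.mpr hx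
  obtain ⟨u, hu⟩ : ∃ u, u = y.1.1 * x.1.1⁻¹ := ⟨_, rfl⟩
  have hux : y.1.1 = u * x.1.1 := by rw [hu, inv_mul_cancel_right₀ hx]
  have hu1 : ‖u‖ = 1 := by rw [hu, norm_mul, norm_inv, ← hn, mul_inv_cancel₀ hn0]
  have hsx : star x.1.1 ≠ 0 := star_ne_zero.mpr hx
  have huq : star u * qi * u = qi := by
    rw [hux, star_mul] at hQ
    have : star x.1.1 * qi * x.1.1 = star x.1.1 * (star u * qi * u) * x.1.1 := by
      rw [hQ]; simp only [mul_assoc]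
    exact (mul_left_cancel₀ hsx (mul_right_cancel₀ hx this)).symm
  -- a unit quaternion commuting with `i` is of the form `e^{iϑ}`
  have hnu := normSq_components u
  have hcomm : qi * u = u * qi := by
    calc qi * u = u * (star u * qi * u) := by
          rw [mul_assoc (star u), ← mul_assoc u, mul_star_self_eq, hu1]; simp
      _ = u * qi := by rw [huq]
  have hJ : u.imJ = 0 := by
    have := congrArg QuaternionAlgebra.imK hcomm
    simp [re_qi, imI_qi, imJ_qi, imK_qi] at this
    linarith
  have hK : u.imK = 0 := by
    have := congrArg QuaternionAlgebra.imJ hcomm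
    simp [re_qi, imI_qi, imJ_qi, imK_qi] at this
    linarith
  obtain ⟨ϑ, hϑ⟩ : ∃ ϑ, u = rot ϑ := by
    rw [hu1, hJ, hK] at hnu
    have hc : ‖(⟨u.re, u.imI⟩ : ℂ)‖ = 1 := by
      rw [Complex.norm_def, Complex.normSq_mk]
      rw [show u.re * u.re + u.imI * u.imI = 1 by linarith, Real.sqrt_one]
    have h0 : (⟨u.re, u.imI⟩ : ℂ) ≠ 0 := by rw [← norm_ne_zero_iff, hc]; exact one_ne_zero
    refine ⟨Complex.arg ⟨u.re, u.imI⟩, Quaternion.ext _ _ ?_ ?_ hJ hK⟩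
    · rw [re_rot, Complex.cos_arg h0, hc, div_one]
    · rw [imI_rot, Complex.sin_arg, hc, div_one]
  refine Quotient.sound ⟨ϑ, Prod.ext ?_ ?_⟩
  · rw [hux, hϑ]
  · have h1 := qi_mul_snd hx
    have h2 := qi_mul_snd hy
    have h3 : qi * y.1.2 = qi * (u * x.1.2) := by
      rw [h2, ← mul_assoc, hcomm, mul_assoc, h1, ← hP, hux, mul_assoc, mul_smul_comm]
    have hq0 : qi ≠ 0 := fun h => by
      have := congrArg QuaternionAlgebra.imI h
      simp [imI_qi] at this
    rw [← hϑ]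
    exact mul_left_cancel₀ hq0 h3

/-- The derivative of the momentum along a vector tangent to `Σ⁰`, described by the derivative of
the relation `i w = 2 z P`. -/
theorem exists_fderiv_KS {x v : Quaternion ℝ × Quaternion ℝ} (hx : x.1 ≠ 0) (hBL : BL x = 0)
    (hv : v ∈ tangentSigma x) :
    ∃ p : Quaternion ℝ, p.re = 0 ∧ fderiv ℝ KS x v =
        (imVec (star v.1 * qi * x.1 + star x.1 * qi * v.1), imVec p) ∧
      qi * v.2 = (2 : ℝ) • (v.1 * momentum x + x.1 * p) := by
  have hnhds := isOpen_fst_ne_zero.mem_nhds (show x ∈ {x | x.1 ≠ 0} from hx)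
  have hM : HasFDerivAt momentum (fderiv ℝ momentum x) x :=
    ((contDiffOn_momentum.contDiffAt hnhds).differentiableAt (by simp)).hasFDerivAt
  -- the line through `x` in the direction `v`
  have hline : HasDerivAt (fun τ : ℝ => x + τ • v) v 0 := by
    simpa using ((hasDerivAt_id (0 : ℝ)).smul_const v).const_add x
  have hl1 : HasDerivAt (fun τ : ℝ => (x + τ • v).1) v.1 0 := hline.fst
  have hl2 : HasDerivAt (fun τ : ℝ => (x + τ • v).2) v.2 0 := hline.snd
  have hx0 : x + (0 : ℝ) • v = x := by simp
  have hMl : HasDerivAt (fun τ : ℝ => momentum (x + τ • v)) (fderiv ℝ momentum x v) 0 :=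
    hM.comp_hasDerivAt_of_eq 0 hline hx0.symm
  have hKS : HasDerivAt (fun τ : ℝ => KS (x + τ • v)) (fderiv ℝ KS x v) 0 :=
    ((contDiffOn_KS.contDiffAt hnhds).differentiableAt (by simp)).hasFDerivAt.comp_hasDerivAt_of_eq
      0 hline hx0.symm
  set p := fderiv ℝ momentum x v with hp
  have hprod : qi * v.2 = (2 : ℝ) • (v.1 * momentum x + x.1 * p) := by
    have h1 := hl2.const_mul qi
    have h2 := (hl1.mul hMl).const_smul (2 : ℝ)
    rw [hx0] at h2
    refine h1.unique (h2.congr_of_eventuallyEq ?_)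
    have hcont : Filter.Tendsto (fun τ : ℝ => x + τ • v) (nhds 0) (nhds x) := by
      have := hline.continuousAt.tendsto
      rwa [hx0] at this
    filter_upwards [hcont hnhds] with τ hτ
    exact qi_mul_snd hτ
  refine ⟨p, ?_, ?_, hprod⟩
  · have hP := momentum_re hBL
    have hw := qi_mul_snd hx
    have ht : (star v.1 * (qi * x.2) + star x.1 * (qi * v.2)).re = 0 := by
      rw [← mul_assoc, ← mul_assoc]; exact hv
    rw [hprod, hw] at ht
    generalize momentum x = P at *
    simp [hP] at ht
    have := normSq_components_pos hx
    refine (mul_eq_zero.mp (?_ : (x.1.re ^ 2 + x.1.imI ^ 2 + x.1.imJ ^ 2 + x.1.imK ^ 2) * p.re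
      = 0)).resolve_left this.ne'
    linear_combination ht / 2
  · have hs := starL.hasFDerivAt.comp_hasDerivAt (0 : ℝ) hl1
    have hQ := imVecL.hasFDerivAt.comp_hasDerivAt (0 : ℝ) ((hs.mul_const qi).mul hl1)
    have hPd := imVecL.hasFDerivAt.comp_hasDerivAt (0 : ℝ) hMl
    refine hKS.unique ((hQ.prodMk hPd).congr_deriv ?_)
    simp [starL_apply, imVecL_apply]

/-- The Kustaanheimo-Stiefel map is symplectic: on `Σ⁰` it pulls `dP ∧ dQ` back to
`Re(dw̄ ∧ dz)`. -/
theorem canonicalForm_eq_KS {x v v' : Quaternion ℝ × Quaternion ℝ} (hx : x.1 ≠ 0)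
    (hBL : BL x = 0) (hv : v ∈ tangentSigma x) (hv' : v' ∈ tangentSigma x) :
    canonicalForm v v' = (fderiv ℝ KS x v).2 ⬝ᵥ (fderiv ℝ KS x v').1
      - (fderiv ℝ KS x v').2 ⬝ᵥ (fderiv ℝ KS x v).1 := by
  obtain ⟨p, hp, hD, hw⟩ := exists_fderiv_KS hx hBL hv
  obtain ⟨p', hp', hD', hw'⟩ := exists_fderiv_KS hx hBL hv'
  have hP := momentum_re hBL
  have hsolve : ∀ a b : Quaternion ℝ, qi * a = b → a = -(qi * b) := by
    intro a b h
    rw [← h, ← mul_assoc, qi_mul_qi]; simp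
  rw [hD, hD', canonicalForm, hsolve _ _ hw, hsolve _ _ hw']
  generalize momentum x = P at *
  simp [imVec, hP, hp, hp', re_qi, imI_qi, imJ_qi, imK_qi]
  ring

/-! ### An explicit section over the coordinate space -/

/-- The quaternion with given components. -/
def quat (a b c d : ℝ) : Quaternion ℝ := ⟨a, b, c, d⟩

@[simp] theorem re_quat (a b c d : ℝ) : (quat a b c d).re = a := rfl
@[simp] theorem imI_quat (a b c d : ℝ) : (quat a b c d).imI = b := rfl
@[simp] theorem imJ_quat (a b c d : ℝ) : (quat a b c d).imJ = c := rfl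
@[simp] theorem imK_quat (a b c d : ℝ) : (quat a b c d).imK = d := rfl

theorem qi_eq_quat : qi = quat 0 1 0 0 := rfl

/-- The smaller semi axis `√((𝓛 / k) (1 - e))` of the ellipse described by the spinor `z`, where
`𝓛 / k` and `e = √(1 - 𝓖² / 𝓛²)` are the semi major axis and the eccentricity of the KS-ellipse. The
formula used is equal to it and has only simple square roots. -/
def spinorMinor (k : ℝ) (a : Fin 3 → ℝ) : ℝ := (√(a 0 + a 1) - √(a 0 - a 1)) / √(2 * k)

/-- The larger semi axis `√((𝓛 / k) (1 + e))` of the ellipse described by the spinor `z`. -/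
def spinorMajor (k : ℝ) (a : Fin 3 → ℝ) : ℝ := (√(a 0 + a 1) + √(a 0 - a 1)) / √(2 * k)

/-- The cosine of half the inclination. -/
def halfIncCos (a : Fin 3 → ℝ) : ℝ := √((a 1 + a 2) / (2 * a 1))

/-- The sine of half the inclination. -/
def halfIncSin (a : Fin 3 → ℝ) : ℝ := √((a 1 - a 2) / (2 * a 1))

/-- The unit quaternion `e^{-k α / 2}`, which rotates by the angle `α` about the vertical. -/
def turnVertical (α : ℝ) : Quaternion ℝ :=
  quat (Real.cos (α / 2)) 0 0 (-Real.sin (α / 2))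

/-- The quaternion `C - i S`, which for `C = cos (ι / 2)` and `S = sin (ι / 2)` rotates by the angle
`ι` about the first axis. -/
def tilt (C S : ℝ) : Quaternion ℝ := quat C (-S) 0 0

/-- The spinor of the position on a horizontal ellipse with pericenter on the first axis: the
Levi-Civita square root of the position. -/
def planarZ (A B δ : ℝ) : Quaternion ℝ :=
  quat (A * Real.cos (δ / 2)) 0 0 (-(B * Real.sin (δ / 2)))

/-- The momentum conjugate to `planarZ` along the regularized Kepler flow. -/
def planarW (k A B δ : ℝ) : Quaternion ℝ :=
  quat (-(2 * k * A * Real.sin (δ / 2))) 0 0 (-(2 * k * B * Real.cos (δ / 2)))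

/-- The rotation carrying the horizontal ellipse with pericenter on the first axis to the ellipse
with given actions, argument of pericenter `t 1` and node `t 2`. -/
def orbitFrame (a t : Fin 3 → ℝ) : Quaternion ℝ :=
  turnVertical (t 1) * tilt (halfIncCos a) (halfIncSin a) * turnVertical (t 2)

/-- A point of `Σ⁰` with actions `a` and angles `t`. The angles enter through their halves: as they
run through a period, the point is carried along its circle orbit. -/
def actionAngleSection (k : ℝ) (q : (Fin 3 → ℝ) × (Fin 3 → ℝ)) : Quaternion ℝ × Quaternion ℝ :=
  (planarZ (spinorMinor k q.1) (spinorMajor k q.1) (q.2 0) * orbitFrame q.1 q.2,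
    planarW k (spinorMinor k q.1) (spinorMajor k q.1) (q.2 0) * orbitFrame q.1 q.2)

section Domain

variable {k : ℝ} {a : Fin 3 → ℝ}

theorem spinorMinor_pos (hk : 0 < k) (ha : a ∈ actionDomain) : 0 < spinorMinor k a := by
  obtain ⟨h1, h2, -⟩ := ha
  refine div_pos (sub_pos.mpr (Real.sqrt_lt_sqrt ?_ ?_)) (Real.sqrt_pos.mpr ?_) <;> linarith

theorem spinorMinor_lt_spinorMajor (hk : 0 < k) (ha : a ∈ actionDomain) :
    spinorMinor k a < spinorMajor k a := by
  obtain ⟨h1, h2, -⟩ := ha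
  have h3 : 0 < √(a 0 - a 1) := Real.sqrt_pos.mpr (by linarith)
  exact div_lt_div_of_pos_right (by linarith) (Real.sqrt_pos.mpr (by linarith))

/-- The action `𝓛` in terms of the semi axes of the spinor ellipse. -/
theorem spinor_sq_add_sq (hk : 0 < k) (ha : a ∈ actionDomain) :
    k * (spinorMinor k a ^ 2 + spinorMajor k a ^ 2) = 2 * a 0 := by
  obtain ⟨h1, h2, -⟩ := ha
  have e1 : √(a 0 + a 1) ^ 2 = a 0 + a 1 := Real.sq_sqrt (by linarith)
  have e2 : √(a 0 - a 1) ^ 2 = a 0 - a 1 := Real.sq_sqrt (by linarith)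
  have e3 : √(2 * k) ^ 2 = 2 * k := Real.sq_sqrt (by linarith)
  rw [spinorMinor, spinorMajor, div_pow, div_pow, e3]
  field_simp
  linear_combination 2 * e1 + 2 * e2

/-- The action `𝓖` in terms of the semi axes of the spinor ellipse. -/
theorem spinor_mul (hk : 0 < k) (ha : a ∈ actionDomain) :
    k * (spinorMinor k a * spinorMajor k a) = a 1 := by
  obtain ⟨h1, h2, -⟩ := ha
  have e1 : √(a 0 + a 1) ^ 2 = a 0 + a 1 := Real.sq_sqrt (by linarith)
  have e2 : √(a 0 - a 1) ^ 2 = a 0 - a 1 := Real.sq_sqrt (by linarith)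
  have e3 : √(2 * k) ^ 2 = 2 * k := Real.sq_sqrt (by linarith)
  rw [spinorMinor, spinorMajor, div_mul_div_comm, ← pow_two (√(2 * k)), e3]
  field_simp
  linear_combination e1 - e2

theorem halfInc_quotients_pos (ha : a ∈ actionDomain) :
    0 < (a 1 + a 2) / (2 * a 1) ∧ 0 < (a 1 - a 2) / (2 * a 1) := by
  obtain ⟨h1, -, h3⟩ := ha
  obtain ⟨h4, h5⟩ := abs_lt.mp h3
  constructor <;> apply div_pos <;> linarith

theorem halfIncCos_sq (ha : a ∈ actionDomain) : halfIncCos a ^ 2 = (a 1 + a 2) / (2 * a 1) :=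
  Real.sq_sqrt (halfInc_quotients_pos ha).1.le

theorem halfIncSin_sq (ha : a ∈ actionDomain) : halfIncSin a ^ 2 = (a 1 - a 2) / (2 * a 1) :=
  Real.sq_sqrt (halfInc_quotients_pos ha).2.le

theorem halfInc_pos (ha : a ∈ actionDomain) : 0 < halfIncCos a ∧ 0 < halfIncSin a :=
  ⟨Real.sqrt_pos.mpr (halfInc_quotients_pos ha).1, Real.sqrt_pos.mpr (halfInc_quotients_pos ha).2⟩

theorem halfInc_sq_add_sq (ha : a ∈ actionDomain) : halfIncCos a ^ 2 + halfIncSin a ^ 2 = 1 := by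
  have := ha.1
  rw [halfIncCos_sq ha, halfIncSin_sq ha]
  field_simp
  ring

/-- The action `𝓗` is `𝓖` times the cosine of the inclination. -/
theorem halfInc_sq_sub_sq (ha : a ∈ actionDomain) :
    a 1 * (halfIncCos a ^ 2 - halfIncSin a ^ 2) = a 2 := by
  have := ha.1
  rw [halfIncCos_sq ha, halfIncSin_sq ha]
  field_simp
  ring

theorem norm_turnVertical (α : ℝ) : ‖turnVertical α‖ = 1 := by
  have h : ‖turnVertical α‖ ^ 2 = 1 := by
    rw [normSq_components, turnVertical]
    simp
  exact (pow_eq_one_iff_of_nonneg (norm_nonneg _) two_ne_zero).mp h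

theorem norm_tilt {C S : ℝ} (h : C ^ 2 + S ^ 2 = 1) : ‖tilt C S‖ = 1 := by
  have h : ‖tilt C S‖ ^ 2 = 1 := by
    rw [normSq_components, tilt]
    simpa using h
  exact (pow_eq_one_iff_of_nonneg (norm_nonneg _) two_ne_zero).mp h

theorem norm_orbitFrame (ha : a ∈ actionDomain) (t : Fin 3 → ℝ) : ‖orbitFrame a t‖ = 1 := by
  simp [orbitFrame, norm_turnVertical, norm_tilt (halfInc_sq_add_sq ha)]

theorem isOpen_actionDomain : IsOpen actionDomain := by
  refine (isOpen_lt continuous_const (continuous_apply 1)).inter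
    ((isOpen_lt (continuous_apply 1) (continuous_apply 0)).inter
      (isOpen_lt (continuous_apply 2).abs (continuous_apply 1)))

end Domain

/-! ### Coordinates of the section -/

/-- The vector into which the rotation `q` carries the vector part of `v`. -/
def rotated (q v : Quaternion ℝ) : Fin 3 → ℝ := imVec (star q * v * q)

/-- The quaternion unit `j`. -/
def qj : Quaternion ℝ := quat 0 0 1 0

/-- The quaternion unit `k`. -/
def qk : Quaternion ℝ := quat 0 0 0 1

/-- A positively oriented orthonormal frame of `ℝ³`. -/
structure IsFrame (e₁ e₂ e₃ : Fin 3 → ℝ) : Prop where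
  cross₁₂ : crossProduct e₁ e₂ = e₃
  cross₂₃ : crossProduct e₂ e₃ = e₁
  cross₃₁ : crossProduct e₃ e₁ = e₂
  dot₁₁ : e₁ ⬝ᵥ e₁ = 1
  dot₂₂ : e₂ ⬝ᵥ e₂ = 1
  dot₃₃ : e₃ ⬝ᵥ e₃ = 1

theorem isFrame_rotated {q : Quaternion ℝ} (hq : ‖q‖ = 1) :
    IsFrame (rotated q qi) (rotated q qj) (rotated q qk) := by
  have h := normSq_components q
  rw [hq, one_pow] at h
  -- inserting powers of `n = ‖q‖²` makes the frame relations polynomial identities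
  obtain ⟨n, hn⟩ : ∃ n, n = q.re ^ 2 + q.imI ^ 2 + q.imJ ^ 2 + q.imK ^ 2 := ⟨_, rfl⟩
  have hn1 : n = 1 := by rw [hn, ← h]
  have c : ∀ v w : Fin 3 → ℝ, v = n • w → v = w := by
    intro v w h; rw [h, hn1, one_smul]
  have d : ∀ x : ℝ, x = n ^ 2 → x = 1 := by
    intro x h; rw [h, hn1, one_pow]
  constructor
  · apply c; rw [hn]; ext i
    fin_cases i <;> simp [rotated, imVec, cross_apply, qi_eq_quat, qj, qk] <;> ring
  · apply c; rw [hn]; ext i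
    fin_cases i <;> simp [rotated, imVec, cross_apply, qi_eq_quat, qj, qk] <;> ring
  · apply c; rw [hn]; ext i
    fin_cases i <;> simp [rotated, imVec, cross_apply, qi_eq_quat, qj, qk] <;> ring
  · apply d; rw [hn]; simp [rotated, imVec, qi_eq_quat]; ring
  · apply d; rw [hn]; simp [rotated, imVec, qj]; ring
  · apply d; rw [hn]; simp [rotated, imVec, qk]; ring

/-- The elements of the state on an ellipse in the plane of `e₁` and `e₂`, in terms of the half
angle of the eccentric anomaly, with cosine `c` and sine `s`. The ellipse is the square, in the
sense of complex numbers, of the ellipse with semi axes `A` and `B`. -/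
theorem elements_of_frame {e₁ e₂ e₃ : Fin 3 → ℝ} (he : IsFrame e₁ e₂ e₃) {k A B c s r : ℝ}
    (hk : 0 < k) (hA : 0 < A) (hcs : c ^ 2 + s ^ 2 = 1)
    (hr : r = A ^ 2 * c ^ 2 + B ^ 2 * s ^ 2) (hrpos : 0 < r) {x : State}
    (hx : x = ((A ^ 2 * c ^ 2 - B ^ 2 * s ^ 2) • e₁ + (2 * A * B * c * s) • e₂,
      (-(k * (A ^ 2 + B ^ 2) * s * c) / r) • e₁ + (k * A * B * (c ^ 2 - s ^ 2) / r) • e₂)) :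
    len x.1 = r ∧ angMom x = (k * (A * B)) • e₃ ∧ redAction k x = k * (A ^ 2 + B ^ 2) / 2 ∧
      x.1 ⬝ᵥ x.2 = k * (B ^ 2 - A ^ 2) * c * s ∧
      redEcc k x = ((B ^ 2 - A ^ 2) / (A ^ 2 + B ^ 2)) • e₁ := by
  have hs2 : s ^ 2 = 1 - c ^ 2 := by linarith
  have d12 : e₁ ⬝ᵥ e₂ = 0 := by rw [← he.cross₃₁, dot_cross_self]
  have d21 : e₂ ⬝ᵥ e₁ = 0 := by rw [dotProduct_comm, d12]
  have c21 : crossProduct e₂ e₁ = -e₃ := by rw [← cross_anticomm, he.cross₁₂]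
  have c13 : crossProduct e₁ e₃ = -e₂ := by rw [← cross_anticomm, he.cross₃₁]
  have hdot : ∀ p q p' q' : ℝ, (p • e₁ + q • e₂) ⬝ᵥ (p' • e₁ + q' • e₂) = p * p' + q * q' := by
    intro p q p' q'
    simp [add_dotProduct, dotProduct_add, smul_dotProduct, dotProduct_smul, d12, d21, he.dot₁₁,
      he.dot₂₂]
    ring
  have hrr : (A ^ 2 * c ^ 2 - B ^ 2 * s ^ 2) ^ 2 + (2 * A * B * c * s) ^ 2 = r ^ 2 := by
    rw [hr]; ring
  have h1 : len x.1 = r := by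
    have : len x.1 ^ 2 = r ^ 2 := by
      rw [len_sq, hx, hdot, ← hrr]; ring
    exact (pow_left_inj₀ (len_nonneg _) hrpos.le two_ne_zero).mp this
  have h2 : angMom x = (k * (A * B)) • e₃ := by
    rw [hx, angMom]
    simp only [map_add, map_smul, LinearMap.add_apply, LinearMap.smul_apply, cross_self,
      he.cross₁₂, c21, smul_zero, zero_add, add_zero, smul_neg, smul_smul,
      ← neg_smul, ← add_smul]
    congr 1
    field_simp
    rw [hr, hs2]; ring
  have h3 : redAction k x = k * (A ^ 2 + B ^ 2) / 2 := by
    rw [redAction, h1, len_sq, hx, hdot]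
    field_simp
    rw [hr, hs2]; ring
  have hAB : 0 < A ^ 2 + B ^ 2 := by positivity
  refine ⟨h1, h2, h3, ?_, ?_⟩
  · rw [hx, hdot]
    field_simp
    rw [hr, hs2]; ring
  · rw [redEcc, h2, h3, h1, hx]
    simp only [map_add, map_smul, LinearMap.add_apply, LinearMap.smul_apply, he.cross₂₃, c13,
      smul_neg, smul_add, smul_smul, ← neg_smul]
    rw [← sub_eq_zero]
    have hz : ∀ p q : ℝ, p = 0 → q = 0 → p • e₁ + q • e₂ = 0 := by
      rintro p q rfl rfl; simp
    -- the coefficients of the difference of the two sides in the frame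
    refine Eq.trans ?_ (hz
      (1 / (k * (k * (A ^ 2 + B ^ 2) / 2)) * (k * (A * B) * (k * A * B * (c ^ 2 - s ^ 2) / r))
        - 1 / r * (A ^ 2 * c ^ 2 - B ^ 2 * s ^ 2) - (B ^ 2 - A ^ 2) / (A ^ 2 + B ^ 2))
      (-(1 / (k * (k * (A ^ 2 + B ^ 2) / 2)) * (k * (A * B) * (-(k * (A ^ 2 + B ^ 2) * s * c) / r)))
        - 1 / r * (2 * A * B * c * s)) ?_ ?_)
    · module
    · field_simp
      rw [hr, hs2]; ring
    · field_simp
      ring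

theorem conj_turnVertical (α x y z : ℝ) :
    star (turnVertical α) * quat 0 x y z * turnVertical α =
      quat 0 (x * Real.cos α - y * Real.sin α) (x * Real.sin α + y * Real.cos α) z := by
  have h := Real.cos_sq_add_sin_sq (α / 2)
  have h1 : Real.cos α = Real.cos (α / 2) ^ 2 - Real.sin (α / 2) ^ 2 := by
    rw [← Real.cos_two_mul']; congr 1; ring
  have h2 : Real.sin α = 2 * Real.sin (α / 2) * Real.cos (α / 2) := by
    rw [← Real.sin_two_mul]; congr 1; ring
  rw [h1, h2, turnVertical]
  generalize Real.cos (α / 2) = c at *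
  generalize Real.sin (α / 2) = s at *
  ext <;> simp
  · ring
  · ring
  · ring
  · linear_combination z * h

theorem conj_tilt {C S : ℝ} (h : C ^ 2 + S ^ 2 = 1) (x y z : ℝ) :
    star (tilt C S) * quat 0 x y z * tilt C S =
      quat 0 x (y * (C ^ 2 - S ^ 2) - z * (2 * C * S)) (y * (2 * C * S) + z * (C ^ 2 - S ^ 2)) := by
  rw [tilt]
  ext <;> simp
  · ring
  · linear_combination x * h
  · ring
  · ring

/-- The vertical components of the first two frame vectors, and the third one, the direction of the
angular momentum. These are all that the coordinates `γ`, `𝓗` and `ζ` depend on. -/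
theorem rotated_orbitFrame {a : Fin 3 → ℝ} (ha : a ∈ actionDomain) (t : Fin 3 → ℝ) :
    rotated (orbitFrame a t) qi 2 = 2 * halfIncCos a * halfIncSin a * Real.sin (t 1) ∧
    rotated (orbitFrame a t) qj 2 = 2 * halfIncCos a * halfIncSin a * Real.cos (t 1) ∧
    rotated (orbitFrame a t) qk = ![2 * halfIncCos a * halfIncSin a * Real.sin (t 2),
      -(2 * halfIncCos a * halfIncSin a * Real.cos (t 2)),
      halfIncCos a ^ 2 - halfIncSin a ^ 2] := by
  have h := halfInc_sq_add_sq ha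
  have key : ∀ v : Quaternion ℝ, rotated (orbitFrame a t) v =
      imVec (star (turnVertical (t 2)) * (star (tilt (halfIncCos a) (halfIncSin a)) *
        (star (turnVertical (t 1)) * v * turnVertical (t 1)) *
          tilt (halfIncCos a) (halfIncSin a)) * turnVertical (t 2)) := fun v => by
    rw [rotated, orbitFrame, star_mul, star_mul]
    simp only [mul_assoc]
  refine ⟨?_, ?_, ?_⟩
  · rw [key, qi_eq_quat, conj_turnVertical, conj_tilt h, conj_turnVertical]; simp [imVec]; ring
  · rw [key, qj, conj_turnVertical, conj_tilt h, conj_turnVertical]; simp [imVec]; ring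
  · rw [key, qk, conj_turnVertical, conj_tilt h, conj_turnVertical]
    ext i; fin_cases i <;> simp [imVec]

section

variable {k : ℝ} {a : Fin 3 → ℝ}

/-- The squared norm of the spinor, which is the distance to the centre of attraction. -/
theorem normSq_planarZ (A B δ : ℝ) : ‖planarZ A B δ‖ ^ 2
    = A ^ 2 * Real.cos (δ / 2) ^ 2 + B ^ 2 * Real.sin (δ / 2) ^ 2 := by
  rw [normSq_components, planarZ]; simp; ring

theorem normSq_planarZ_pos (hk : 0 < k) (ha : a ∈ actionDomain) (δ : ℝ) :
    0 < ‖planarZ (spinorMinor k a) (spinorMajor k a) δ‖ ^ 2 := by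
  have hA := spinorMinor_pos hk ha
  have hB := hA.trans (spinorMinor_lt_spinorMajor hk ha)
  have hcs := Real.cos_sq_add_sin_sq (δ / 2)
  rw [normSq_planarZ]
  have h1 : (0 : ℝ) ≤ spinorMinor k a ^ 2 * Real.cos (δ / 2) ^ 2 := by positivity
  have h2 : (0 : ℝ) ≤ spinorMajor k a ^ 2 * Real.sin (δ / 2) ^ 2 := by positivity
  rcases eq_or_ne (Real.cos (δ / 2)) 0 with h | h
  · rw [h] at hcs ⊢
    have : Real.sin (δ / 2) ^ 2 = 1 := by linarith
    rw [this]; positivity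
  · have : 0 < spinorMinor k a ^ 2 * Real.cos (δ / 2) ^ 2 := by positivity
    linarith

theorem actionAngleSection_fst_ne_zero (hk : 0 < k) {q : (Fin 3 → ℝ) × (Fin 3 → ℝ)}
    (hq : q.1 ∈ actionDomain) : (actionAngleSection k q).1 ≠ 0 := by
  have h := normSq_planarZ_pos hk hq (q.2 0)
  rw [actionAngleSection, ← norm_ne_zero_iff, norm_mul, norm_orbitFrame hq, mul_one]
  exact fun h' => by rw [h'] at h; simp at h

theorem conj_planarZ_planarZ (A B δ : ℝ) : star (planarZ A B δ) * qi * planarZ A B δ =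
    (A ^ 2 * Real.cos (δ / 2) ^ 2 - B ^ 2 * Real.sin (δ / 2) ^ 2) • qi
      + (2 * A * B * Real.cos (δ / 2) * Real.sin (δ / 2)) • qj := by
  rw [planarZ, qi_eq_quat, qj]
  ext <;> simp <;> ring

theorem conj_planarZ_planarW (k A B δ : ℝ) : star (planarZ A B δ) * qi * planarW k A B δ =
    (-(2 * (k * (A ^ 2 + B ^ 2) * Real.sin (δ / 2) * Real.cos (δ / 2)))) • qi
      + (2 * (k * A * B * (Real.cos (δ / 2) ^ 2 - Real.sin (δ / 2) ^ 2))) • qj := by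
  rw [planarZ, planarW, qi_eq_quat, qj]
  ext <;> simp <;> ring

theorem imVec_conj (q u v : Quaternion ℝ) (x y : ℝ) :
    imVec (star q * (x • u + y • v) * q) = x • rotated q u + y • rotated q v := by
  simp only [rotated, ← imVecL_apply, mul_add, add_mul, mul_smul_comm, smul_mul_assoc, map_add,
    map_smul]

theorem BL_actionAngleSection (k : ℝ) (q : (Fin 3 → ℝ) × (Fin 3 → ℝ)) :
    BL (actionAngleSection k q) = 0 := by
  have h : star (actionAngleSection k q).1 * qi * (actionAngleSection k q).2 =
      star (orbitFrame q.1 q.2) * (star (planarZ (spinorMinor k q.1) (spinorMajor k q.1) (q.2 0)) *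
        qi * planarW k (spinorMinor k q.1) (spinorMajor k q.1) (q.2 0)) * orbitFrame q.1 q.2 := by
    simp only [actionAngleSection, star_mul, mul_assoc]
  rw [BL, h, conj_planarZ_planarW]
  generalize orbitFrame q.1 q.2 = p
  rw [qi_eq_quat, qj]
  simp
  ring

theorem actionAngleSection_mem (hk : 0 < k) {q : (Fin 3 → ℝ) × (Fin 3 → ℝ)}
    (hq : q.1 ∈ actionDomain) : actionAngleSection k q ∈ SigmaZero :=
  ⟨BL_actionAngleSection k q, fun h => actionAngleSection_fst_ne_zero hk hq (by rw [h]; rfl)⟩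

theorem KS_actionAngleSection {q : (Fin 3 → ℝ) × (Fin 3 → ℝ)}
    (hq : q.1 ∈ actionDomain) {A B c s r : ℝ} (hA : A = spinorMinor k q.1)
    (hB : B = spinorMajor k q.1) (hc : c = Real.cos (q.2 0 / 2)) (hs : s = Real.sin (q.2 0 / 2))
    (hr : r = A ^ 2 * c ^ 2 + B ^ 2 * s ^ 2) :
    KS (actionAngleSection k q) =
      ((A ^ 2 * c ^ 2 - B ^ 2 * s ^ 2) • rotated (orbitFrame q.1 q.2) qi
        + (2 * A * B * c * s) • rotated (orbitFrame q.1 q.2) qj,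
      (-(k * (A ^ 2 + B ^ 2) * s * c) / r) • rotated (orbitFrame q.1 q.2) qi
        + (k * A * B * (c ^ 2 - s ^ 2) / r) • rotated (orbitFrame q.1 q.2) qj) := by
  subst hA hB hc hs
  have hn : ‖(actionAngleSection k q).1‖ ^ 2 = r := by
    rw [actionAngleSection, norm_mul, norm_orbitFrame hq, mul_one, normSq_planarZ, hr]
  refine Prod.ext ?_ ?_
  · rw [← imVec_conj, ← conj_planarZ_planarZ]
    simp only [KS, actionAngleSection, star_mul, mul_assoc]
  · have h2 := imVec_conj (orbitFrame q.1 q.2) qi qj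
      (-(2 * (k * (spinorMinor k q.1 ^ 2 + spinorMajor k q.1 ^ 2) * Real.sin (q.2 0 / 2) *
        Real.cos (q.2 0 / 2)))) (2 * (k * spinorMinor k q.1 * spinorMajor k q.1 *
        (Real.cos (q.2 0 / 2) ^ 2 - Real.sin (q.2 0 / 2) ^ 2)))
    rw [← conj_planarZ_planarW] at h2
    have h3 : star (actionAngleSection k q).1 * qi * (actionAngleSection k q).2 =
      star (orbitFrame q.1 q.2) * (star (planarZ (spinorMinor k q.1) (spinorMajor k q.1) (q.2 0)) *
        qi * planarW k (spinorMinor k q.1) (spinorMajor k q.1) (q.2 0)) * orbitFrame q.1 q.2 := by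
      simp only [actionAngleSection, star_mul, mul_assoc]
    change imVecL ((1 / (2 * ‖(actionAngleSection k q).1‖ ^ 2)) • _) = _
    rw [hn, map_smul, imVecL_apply, h3, h2, smul_add, smul_smul, smul_smul]
    congr 2
    · rw [mul_comm 2 r, ← div_div]; ring
    · rw [mul_comm 2 r, ← div_div]; ring

/-- The section inverts the coordinates. -/
theorem stateCoords_actionAngleSection (hk : 0 < k) {q : (Fin 3 → ℝ) × (Fin 3 → ℝ)}
    (hq : q.1 ∈ actionDomain) :
    KS (actionAngleSection k q) ∈ goodStates k ∧
      stateCoords k (KS (actionAngleSection k q)) = (q.1, toAngles q.2) := by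
  have hA := spinorMinor_pos hk hq
  have hAB := spinorMinor_lt_spinorMajor hk hq
  have hrpos := normSq_planarZ_pos hk hq (q.2 0)
  rw [normSq_planarZ] at hrpos
  have hL := spinor_sq_add_sq hk hq
  have hG := spinor_mul hk hq
  have hH := halfInc_sq_sub_sq hq
  have hG0 := hq.1
  obtain ⟨hC0, hS0⟩ := halfInc_pos hq
  have hframe := isFrame_rotated (norm_orbitFrame hq q.2)
  have hKS := KS_actionAngleSection (k := k) hq rfl rfl rfl rfl rfl
  obtain ⟨hlen, hang, hact, hQP, hecc⟩ := elements_of_frame hframe hk hA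
    (Real.cos_sq_add_sin_sq (q.2 0 / 2)) rfl hrpos hKS
  obtain ⟨h1, h2, h3⟩ := rotated_orbitFrame hq q.2
  have hc : Real.cos (q.2 0) = Real.cos (q.2 0 / 2) ^ 2 - Real.sin (q.2 0 / 2) ^ 2 := by
    rw [← Real.cos_two_mul']; congr 1; ring
  have hs : Real.sin (q.2 0) = 2 * Real.sin (q.2 0 / 2) * Real.cos (q.2 0 / 2) := by
    rw [← Real.sin_two_mul]; congr 1; ring
  have hcs := Real.cos_sq_add_sin_sq (q.2 0 / 2)
  have hfst := KS_fst_eq_zero_iff (x := actionAngleSection k q)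
  have hz := actionAngleSection_fst_ne_zero hk hq
  generalize KS (actionAngleSection k q) = x at *
  generalize spinorMinor k q.1 = A at *
  generalize spinorMajor k q.1 = B at *
  generalize Real.cos (q.2 0 / 2) = c at *
  generalize Real.sin (q.2 0 / 2) = s at *
  generalize halfIncCos q.1 = C at *
  generalize halfIncSin q.1 = S at *
  generalize rotated (orbitFrame q.1 q.2) qi = e₁ at *
  generalize rotated (orbitFrame q.1 q.2) qj = e₂ at *
  generalize he₃ : rotated (orbitFrame q.1 q.2) qk = e₃ at *
  rw [hG] at hang
  have hact : redAction k x = q.1 0 := by rw [hact, hL]; ring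
  have hlang : len (angMom x) = q.1 1 := by
    have h1 : len e₃ = 1 := by rw [len, hframe.dot₃₃, Real.sqrt_one]
    rw [hang, len_smul hG0.le, h1, mul_one]
  have hA2 : 0 < B ^ 2 - A ^ 2 := by nlinarith
  have he : 0 < (B ^ 2 - A ^ 2) / (A ^ 2 + B ^ 2) := by positivity
  have hsi : 0 < 2 * C * S := by positivity
  have he₁ : e₁ ≠ 0 := fun h => by
    have := hframe.dot₁₁
    rw [h] at this; simp at this
  -- the ascending node
  have hn : nodeVec x = ![q.1 1 * (2 * C * S) * Real.cos (q.2 2),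
      q.1 1 * (2 * C * S) * Real.sin (q.2 2), 0] := by
    rw [nodeVec_apply, hang, h3]
    ext i
    fin_cases i <;> simp <;> ring
  have hδ : polarAngle (redAction k x - k * len x.1) (x.1 ⬝ᵥ x.2) = (q.2 0 : Real.Angle) := by
    have hpos : 0 < k * (B ^ 2 - A ^ 2) / 2 := by positivity
    have e1 : q.1 0 - k * (A ^ 2 * c ^ 2 + B ^ 2 * s ^ 2)
        = k * (B ^ 2 - A ^ 2) / 2 * Real.cos (q.2 0) := by
      have : q.1 0 = k * (A ^ 2 + B ^ 2) / 2 * (c ^ 2 + s ^ 2) := by rw [hcs]; linarith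
      rw [this, hc]; ring
    have e2 : k * (B ^ 2 - A ^ 2) * c * s = k * (B ^ 2 - A ^ 2) / 2 * Real.sin (q.2 0) := by
      rw [hs]; ring
    rw [hact, hlen, hQP, e1, e2, polarAngle_cos_sin hpos]
  have hγ : polarAngle (len (angMom x) * (nodeVec x ⬝ᵥ redEcc k x))
      (crossProduct (angMom x) (nodeVec x) ⬝ᵥ redEcc k x) = (q.2 1 : Real.Angle) := by
    have h31 : e₃ ⬝ᵥ e₁ = 0 := by rw [← hframe.cross₁₂, dotProduct_comm, dot_self_cross]
    -- `n · e₁` and `(C × n) · e₁` are the vertical components of `e₂` and `e₁`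
    have e1 : nodeVec x ⬝ᵥ e₁ = q.1 1 * e₂ 2 := by
      rw [← hframe.cross₃₁, nodeVec_apply, hang]
      simp [cross_apply, dotProduct, Fin.sum_univ_three]; ring
    have e2 : crossProduct (angMom x) (nodeVec x) ⬝ᵥ e₁ = q.1 1 ^ 2 * e₁ 2 := by
      rw [nodeVec, cross_cross_eq_smul_sub_smul', hang, sub_dotProduct]
      have hv : vertical ⬝ᵥ e₁ = e₁ 2 := by simp [vertical, dotProduct, Fin.sum_univ_three]
      simp only [smul_dotProduct, dotProduct_smul, smul_eq_mul, h31, hframe.dot₃₃, hv]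
      ring
    rw [hecc, dotProduct_smul, dotProduct_smul, e1, e2, hlang, smul_eq_mul, smul_eq_mul, h1, h2,
      ← polarAngle_cos_sin (c := (B ^ 2 - A ^ 2) / (A ^ 2 + B ^ 2) * q.1 1 ^ 2 * (2 * C * S))
        (by positivity)]
    congr 1 <;> ring
  have hζ : polarAngle (nodeVec x 0) (nodeVec x 1) = (q.2 2 : Real.Angle) := by
    rw [hn]
    exact polarAngle_cos_sin (by positivity) _
  refine ⟨⟨fun h => hz (hfst.mp h), fun h => ?_, ?_, fun h => ?_⟩, Prod.ext ?_ ?_⟩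
  · rw [h] at hlang
    simp [len] at hlang
    linarith
  · rw [hecc]
    exact smul_ne_zero he.ne' he₁
  · have hp : 0 < q.1 1 * (2 * C * S) := by positivity
    rw [hn] at h
    have h0 := congrFun h 0
    have h1 := congrFun h 1
    simp only [Matrix.cons_val_zero, Matrix.cons_val_one, Pi.zero_apply, mul_eq_zero, hp.ne',
      false_or] at h0 h1
    have := Real.cos_sq_add_sin_sq (q.2 2)
    rw [(by simpa [hG0.ne', hC0.ne', hS0.ne'] using h0 : Real.cos (q.2 2) = 0),
      (by simpa [hG0.ne', hC0.ne', hS0.ne'] using h1 : Real.sin (q.2 2) = 0)] at this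
    simp at this
  · ext i
    fin_cases i
    · exact hact
    · exact hlang
    · change angMom x 2 = q.1 2
      rw [hang, h3]
      simpa using hH
  · ext i
    fin_cases i
    · exact hδ
    · exact hγ
    · exact hζ

end

/-! ### The section is smooth and symplectic -/

/-- The linear map assembling a quaternion from its components. -/
def quatL : ℝ × ℝ × ℝ × ℝ →L[ℝ] Quaternion ℝ :=
  LinearMap.toContinuousLinearMap
    { toFun := fun x => quat x.1 x.2.1 x.2.2.1 x.2.2.2
      map_add' := fun p q => by ext <;> simp
      map_smul' := fun c q => by ext <;> simp }

theorem contDiffOn_quat {E : Type*} [NormedAddCommGroup E] [NormedSpace ℝ E] {s : Set E}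
    {f g : E → ℝ} (hf : ContDiffOn ℝ ∞ f s) (hg : ContDiffOn ℝ ∞ g s) {u v : E → ℝ}
    (hu : ContDiffOn ℝ ∞ u s) (hv : ContDiffOn ℝ ∞ v s) :
    ContDiffOn ℝ ∞ (fun x => quat (f x) (g x) (u x) (v x)) s :=
  quatL.contDiff.comp_contDiffOn (hf.prodMk (hg.prodMk (hu.prodMk hv)))

theorem hasDerivAt_quat {f g u v : ℝ → ℝ} {f' g' u' v' x : ℝ} (hf : HasDerivAt f f' x)
    (hg : HasDerivAt g g' x) (hu : HasDerivAt u u' x) (hv : HasDerivAt v v' x) :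
    HasDerivAt (fun x => quat (f x) (g x) (u x) (v x)) (quat f' g' u' v') x :=
  quatL.hasFDerivAt.comp_hasDerivAt x (hf.prodMk (hg.prodMk (hu.prodMk hv)))

section Smooth

variable {k : ℝ}

theorem contDiff_apply_three (i : Fin 3) : ContDiff ℝ ∞ fun a : Fin 3 → ℝ => a i :=
  contDiff_apply ℝ ℝ i

theorem contDiffOn_sqrt_add_sub :
    ContDiffOn ℝ ∞ (fun a : Fin 3 → ℝ => √(a 0 + a 1)) actionDomain ∧
      ContDiffOn ℝ ∞ (fun a : Fin 3 → ℝ => √(a 0 - a 1)) actionDomain := by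
  refine ⟨ContDiffOn.sqrt ((contDiff_apply_three 0).add (contDiff_apply_three 1)).contDiffOn ?_,
    ContDiffOn.sqrt ((contDiff_apply_three 0).sub (contDiff_apply_three 1)).contDiffOn ?_⟩
  · rintro a ⟨h1, h2, -⟩
    linarith
  · rintro a ⟨h1, h2, -⟩
    linarith

theorem contDiffOn_spinorMinor : ContDiffOn ℝ ∞ (spinorMinor k) actionDomain :=
  (contDiffOn_sqrt_add_sub.1.sub contDiffOn_sqrt_add_sub.2).div_const _

theorem contDiffOn_spinorMajor : ContDiffOn ℝ ∞ (spinorMajor k) actionDomain :=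
  (contDiffOn_sqrt_add_sub.1.add contDiffOn_sqrt_add_sub.2).div_const _

theorem contDiffOn_halfIncCos : ContDiffOn ℝ ∞ halfIncCos actionDomain := by
  refine ContDiffOn.sqrt (ContDiffOn.div ((contDiff_apply_three 1).add
    (contDiff_apply_three 2)).contDiffOn (contDiff_const.mul (contDiff_apply_three 1)).contDiffOn
    ?_) fun a ha => (halfInc_quotients_pos ha).1.ne'
  rintro a ⟨h1, -⟩
  positivity

theorem contDiffOn_halfIncSin : ContDiffOn ℝ ∞ halfIncSin actionDomain := by
  refine ContDiffOn.sqrt (ContDiffOn.div ((contDiff_apply_three 1).sub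
    (contDiff_apply_three 2)).contDiffOn (contDiff_const.mul (contDiff_apply_three 1)).contDiffOn
    ?_) fun a ha => (halfInc_quotients_pos ha).2.ne'
  rintro a ⟨h1, -⟩
  positivity

theorem isOpen_fst_mem_actionDomain :
    IsOpen {q : (Fin 3 → ℝ) × (Fin 3 → ℝ) | q.1 ∈ actionDomain} :=
  isOpen_actionDomain.preimage continuous_fst

theorem contDiffOn_actionAngleSection : ContDiffOn ℝ ∞ (actionAngleSection k)
    {q : (Fin 3 → ℝ) × (Fin 3 → ℝ) | q.1 ∈ actionDomain} := by
  have hfst : ∀ {f : (Fin 3 → ℝ) → ℝ}, ContDiffOn ℝ ∞ f actionDomain →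
      ContDiffOn ℝ ∞ (fun q : (Fin 3 → ℝ) × (Fin 3 → ℝ) => f q.1) {q | q.1 ∈ actionDomain} :=
    fun hf => hf.comp contDiff_fst.contDiffOn fun _ h => h
  have ht : ∀ i, ContDiff ℝ ∞ fun q : (Fin 3 → ℝ) × (Fin 3 → ℝ) => q.2 i / 2 := fun i =>
    ((contDiff_apply_three i).comp contDiff_snd).div_const 2
  have hcos := fun i => ((ht i).cos).contDiffOn (s := {q | q.1 ∈ actionDomain})
  have hsin := fun i => ((ht i).sin).contDiffOn (s := {q | q.1 ∈ actionDomain})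
  have hA := hfst (contDiffOn_spinorMinor (k := k))
  have hB := hfst (contDiffOn_spinorMajor (k := k))
  have hturn : ∀ i, ContDiffOn ℝ ∞ (fun q : (Fin 3 → ℝ) × (Fin 3 → ℝ) => turnVertical (q.2 i))
      {q | q.1 ∈ actionDomain} := fun i =>
    contDiffOn_quat (hcos i) contDiffOn_const contDiffOn_const (hsin i).neg
  have hframe : ContDiffOn ℝ ∞ (fun q : (Fin 3 → ℝ) × (Fin 3 → ℝ) => orbitFrame q.1 q.2)
      {q | q.1 ∈ actionDomain} :=
    ((hturn 1).mul (contDiffOn_quat (hfst contDiffOn_halfIncCos)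
      (hfst contDiffOn_halfIncSin).neg contDiffOn_const contDiffOn_const)).mul (hturn 2)
  refine ContDiffOn.prodMk (ContDiffOn.mul ?_ hframe) (ContDiffOn.mul ?_ hframe)
  · exact contDiffOn_quat (hA.mul (hcos 0)) contDiffOn_const contDiffOn_const
      (hB.mul (hsin 0)).neg
  · exact contDiffOn_quat ((contDiffOn_const.mul hA).mul (hsin 0)).neg contDiffOn_const
      contDiffOn_const ((contDiffOn_const.mul hB).mul (hcos 0)).neg

end Smooth

/-- The canonical form is invariant under multiplication by unit quaternions on both sides. -/
theorem canonicalForm_mul {g p : Quaternion ℝ} (hg : ‖g‖ = 1) (hp : ‖p‖ = 1)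
    (a b a' b' : Quaternion ℝ) :
    canonicalForm (g * a * p, g * b * p) (g * a' * p, g * b' * p)
      = canonicalForm (a, b) (a', b') := by
  have h1 : ∀ x y : Quaternion ℝ, star (g * x * p) * (g * y * p) = star p * (star x * y) * p := by
    intro x y
    calc star (g * x * p) * (g * y * p) = star p * star x * (star g * g) * y * p := by
          simp only [star_mul, mul_assoc]
      _ = star p * (star x * y) * p := by
          rw [star_mul_self_eq, hg]; simp [mul_assoc]
  have h2 : ∀ x : Quaternion ℝ, (star p * x * p).re = x.re := by
    intro x
    have h := normSq_components p
    rw [hp, one_pow] at h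
    simp
    linear_combination (-x.re) * h
  simp only [canonicalForm, h1, Quaternion.re_sub, h2]

theorem quat_mul_turnVertical (x y α : ℝ) :
    quat x 0 0 y * turnVertical α = turnVertical α * quat x 0 0 y := by
  rw [turnVertical]
  ext <;> simp <;> ring

theorem hasDerivAt_turnVertical {f : ℝ → ℝ} {f' x : ℝ} (hf : HasDerivAt f f' x) :
    HasDerivAt (fun x => turnVertical (f x)) (quat 0 0 0 (-(f' / 2)) * turnVertical (f x)) x := by
  have h := (hf.div_const 2)
  refine (hasDerivAt_quat h.cos (hasDerivAt_const x 0) (hasDerivAt_const x 0)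
    h.sin.neg).congr_deriv ?_
  rw [turnVertical]
  ext <;> simp <;> ring

theorem hasDerivAt_tilt {C S : ℝ → ℝ} {C' S' x : ℝ} (hC : HasDerivAt C C' x)
    (hS : HasDerivAt S S' x) (h : C x ^ 2 + S x ^ 2 = 1) (h' : C x * C' + S x * S' = 0) :
    HasDerivAt (fun x => tilt (C x) (S x))
      (quat 0 (C' * S x - S' * C x) 0 0 * tilt (C x) (S x)) x := by
  refine (hasDerivAt_quat hC hS.neg (hasDerivAt_const x 0) (hasDerivAt_const x 0)).congr_deriv ?_
  rw [tilt]
  ext <;> simp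
  · linear_combination (-C') * h + C x * h'
  · linear_combination (S') * h - S x * h'

theorem tilt_mul {C S : ℝ} (h : C ^ 2 + S ^ 2 = 1) (y : ℝ) :
    tilt C S * quat 0 0 0 y
      = quat 0 0 (y * (2 * C * S)) (y * (C ^ 2 - S ^ 2)) * tilt C S := by
  rw [tilt]
  ext <;> simp
  · linear_combination (-y * S) * h
  · linear_combination (-y * C) * h

/-- The product rule for a planar spinor times the rotation of the orbital frame, with the
derivatives of the rotation collected into one infinitesimal rotation. Moving them past the first factor is
possible because the planar spinors commute with rotations about the vertical. -/
theorem mul_frame_add (x y x' y' α β ν τ₁ τ₂ : ℝ) {C S : ℝ} (h : C ^ 2 + S ^ 2 = 1) :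
    quat x' 0 0 y' * (turnVertical α * tilt C S * turnVertical β) +
        quat x 0 0 y * ((quat 0 0 0 (-(τ₁ / 2)) * turnVertical α * tilt C S +
          turnVertical α * (quat 0 ν 0 0 * tilt C S)) * turnVertical β +
            turnVertical α * tilt C S * (quat 0 0 0 (-(τ₂ / 2)) * turnVertical β))
      = turnVertical α * (quat x' 0 0 y' + quat x 0 0 y *
          quat 0 ν (-(τ₂ * C * S)) (-((τ₁ + τ₂ * (C ^ 2 - S ^ 2)) / 2))) *
        (tilt C S * turnVertical β) := by
  have hΩ : quat 0 ν (-(τ₂ * C * S)) (-((τ₁ + τ₂ * (C ^ 2 - S ^ 2)) / 2)) =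
      quat 0 0 0 (-(τ₁ / 2)) + quat 0 ν 0 0 +
        quat 0 0 (-(τ₂ / 2) * (2 * C * S)) (-(τ₂ / 2) * (C ^ 2 - S ^ 2)) := by
    ext <;> simp <;> ring
  have h1 := quat_mul_turnVertical x' y' α
  have h2 := quat_mul_turnVertical x y α
  have h3 := quat_mul_turnVertical 0 (-(τ₁ / 2)) α
  have h4 := tilt_mul h (-(τ₂ / 2))
  rw [hΩ]
  generalize quat x' 0 0 y' = ζ' at *
  generalize quat x 0 0 y = ζ at *
  generalize quat 0 0 0 (-(τ₁ / 2)) = κ₁ at *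
  generalize quat 0 0 0 (-(τ₂ / 2)) = κ₂ at *
  generalize turnVertical α = g at *
  generalize turnVertical β = p at *
  generalize tilt C S = n at *
  calc _ = ζ' * g * n * p + ζ * (κ₁ * g) * n * p + ζ * g * (quat 0 ν 0 0 * n) * p
        + ζ * g * (n * κ₂) * p := by noncomm_ring
    _ = _ := by rw [h3, h4, h1, ← mul_assoc ζ, h2]; noncomm_ring

/-- The derivative of the section in the direction `ξ`, with the rotations split off. The
infinitesimal rotation `ν i + …` is the angular velocity of the orbital frame, seen from the frame
attached to the ascending node. -/
theorem exists_fderiv_actionAngleSection {k : ℝ} (hk : 0 < k)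
    {q : (Fin 3 → ℝ) × (Fin 3 → ℝ)} (hq : q.1 ∈ actionDomain) (ξ : (Fin 3 → ℝ) × (Fin 3 → ℝ))
    {A B C S c s : ℝ} (hA : A = spinorMinor k q.1) (hB : B = spinorMajor k q.1)
    (hC : C = halfIncCos q.1) (hS : S = halfIncSin q.1) (hc : c = Real.cos (q.2 0 / 2))
    (hs : s = Real.sin (q.2 0 / 2)) :
    ∃ A' B' ν : ℝ, k * (A * A' + B * B') = ξ.1 0 ∧ k * (A' * B + A * B') = ξ.1 1 ∧
      ξ.1 1 * (C ^ 2 - S ^ 2) + 4 * q.1 1 * C * S * ν = ξ.1 2 ∧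
      fderiv ℝ (actionAngleSection k) q ξ =
        (turnVertical (q.2 1) *
          (quat (A' * c - A * s * (ξ.2 0 / 2)) 0 0 (-(B' * s + B * c * (ξ.2 0 / 2))) +
            quat (A * c) 0 0 (-(B * s)) *
              quat 0 ν (-(ξ.2 2 * C * S)) (-((ξ.2 1 + ξ.2 2 * (C ^ 2 - S ^ 2)) / 2))) *
          (tilt C S * turnVertical (q.2 2)),
        turnVertical (q.2 1) *
          (quat (-(2 * k * (A' * s + A * c * (ξ.2 0 / 2)))) 0 0
              (-(2 * k * (B' * c - B * s * (ξ.2 0 / 2)))) +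
            quat (-(2 * k * A * s)) 0 0 (-(2 * k * B * c)) *
              quat 0 ν (-(ξ.2 2 * C * S)) (-((ξ.2 1 + ξ.2 2 * (C ^ 2 - S ^ 2)) / 2))) *
          (tilt C S * turnVertical (q.2 2))) := by
  have hline : HasDerivAt (fun τ : ℝ => q + τ • ξ) ξ 0 := by
    simpa using ((hasDerivAt_id (0 : ℝ)).smul_const ξ).const_add q
  have hq0 : q + (0 : ℝ) • ξ = q := by simp
  have hline1 : HasDerivAt (fun τ : ℝ => (q + τ • ξ).1) ξ.1 0 := hline.fst
  have hline2 : HasDerivAt (fun τ : ℝ => (q + τ • ξ).2) ξ.2 0 := hline.snd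
  have ha : ∀ i, HasDerivAt (fun τ : ℝ => (q + τ • ξ).1 i) (ξ.1 i) 0 :=
    hasDerivAt_pi.mp hline1
  have ht : ∀ i, HasDerivAt (fun τ : ℝ => (q + τ • ξ).2 i) (ξ.2 i) 0 :=
    hasDerivAt_pi.mp hline2
  have hmem : ∀ᶠ τ : ℝ in nhds 0, (q + τ • ξ).1 ∈ actionDomain := by
    refine hline1.continuousAt.eventually (isOpen_actionDomain.mem_nhds ?_)
    simpa using hq
  have hfun : ∀ {f : (Fin 3 → ℝ) → ℝ}, ContDiffOn ℝ ∞ f actionDomain →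
      HasDerivAt (fun τ : ℝ => f (q + τ • ξ).1) (fderiv ℝ f q.1 ξ.1) 0 := fun hf =>
    ((hf.contDiffAt (isOpen_actionDomain.mem_nhds hq)).differentiableAt
      (by simp)).hasFDerivAt.comp_hasDerivAt_of_eq 0 hline1 (by rw [hq0])
  have hsec := ((contDiffOn_actionAngleSection (k := k)).contDiffAt
      (isOpen_fst_mem_actionDomain.mem_nhds hq)).differentiableAt
      (by simp) |>.hasFDerivAt.comp_hasDerivAt_of_eq (0 : ℝ) hline hq0.symm
  have dA := hfun (contDiffOn_spinorMinor (k := k))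
  have dB := hfun (contDiffOn_spinorMajor (k := k))
  have dC := hfun contDiffOn_halfIncCos
  have dS := hfun contDiffOn_halfIncSin
  -- differentiate the algebraic relations between the semi axes, the inclination and the actions
  have r1 : k * (2 * (A * fderiv ℝ (spinorMinor k) q.1 ξ.1)
      + 2 * (B * fderiv ℝ (spinorMajor k) q.1 ξ.1)) = 2 * ξ.1 0 := by
    have h := ((dA.pow 2).add (dB.pow 2)).const_mul k
    have h' := ((ha 0).const_mul 2).congr_of_eventuallyEq
      (hmem.mono fun τ hτ => spinor_sq_add_sq hk hτ)
    have := h.unique h'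
    simp only [hq0, ← hA, ← hB, Nat.cast_ofNat, Nat.reduceSub, pow_one] at this
    linear_combination this
  have r2 : k * (fderiv ℝ (spinorMinor k) q.1 ξ.1 * B
      + A * fderiv ℝ (spinorMajor k) q.1 ξ.1) = ξ.1 1 := by
    have h := (dA.mul dB).const_mul k
    have h' := (ha 1).congr_of_eventuallyEq (hmem.mono fun τ hτ => spinor_mul hk hτ)
    have := h.unique h'
    rw [← this, hA, hB]
    simp
  have r3 : C * fderiv ℝ halfIncCos q.1 ξ.1 + S * fderiv ℝ halfIncSin q.1 ξ.1 = 0 := by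
    have h := (dC.pow 2).add (dS.pow 2)
    have h' := (hasDerivAt_const (0 : ℝ) (1 : ℝ)).congr_of_eventuallyEq
      (hmem.mono fun τ hτ => halfInc_sq_add_sq hτ)
    have := h.unique h'
    simp [← hC, ← hS] at this
    linear_combination this / 2
  have r4 : ξ.1 1 * (C ^ 2 - S ^ 2) + q.1 1 * (2 * (C * fderiv ℝ halfIncCos q.1 ξ.1)
      - 2 * (S * fderiv ℝ halfIncSin q.1 ξ.1)) = ξ.1 2 := by
    have h := (ha 1).mul ((dC.pow 2).sub (dS.pow 2))
    have h' := (ha 2).congr_of_eventuallyEq (hmem.mono fun τ hτ => halfInc_sq_sub_sq hτ)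
    have := h.unique h'
    simp only [hq0, ← hC, ← hS, Nat.cast_ofNat, Nat.reduceSub, pow_one, Pi.sub_apply,
      Pi.pow_apply] at this
    linear_combination this
  have hCS : C ^ 2 + S ^ 2 = 1 := by rw [hC, hS]; exact halfInc_sq_add_sq hq
  have hz : HasDerivAt (fun τ : ℝ => quat
      (spinorMinor k (q + τ • ξ).1 * Real.cos ((q + τ • ξ).2 0 / 2)) 0 0
      (-(spinorMajor k (q + τ • ξ).1 * Real.sin ((q + τ • ξ).2 0 / 2)))) _ 0 :=
    hasDerivAt_quat (dA.mul ((ht 0).div_const 2).cos) (hasDerivAt_const _ _)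
      (hasDerivAt_const _ _) (dB.mul ((ht 0).div_const 2).sin).neg
  have hw : HasDerivAt (fun τ : ℝ => quat
      (-(2 * k * spinorMinor k (q + τ • ξ).1 * Real.sin ((q + τ • ξ).2 0 / 2))) 0 0
      (-(2 * k * spinorMajor k (q + τ • ξ).1 * Real.cos ((q + τ • ξ).2 0 / 2)))) _ 0 :=
    hasDerivAt_quat ((dA.const_mul (2 * k)).mul ((ht 0).div_const 2).sin).neg
      (hasDerivAt_const _ _) (hasDerivAt_const _ _)
      ((dB.const_mul (2 * k)).mul ((ht 0).div_const 2).cos).neg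
  have hn := hasDerivAt_tilt dC dS (by rw [hq0]; exact halfInc_sq_add_sq hq)
    (by rw [hq0, ← hC, ← hS]; exact r3)
  have hframe := ((hasDerivAt_turnVertical (ht 1)).mul hn).mul (hasDerivAt_turnVertical (ht 2))
  generalize fderiv ℝ (spinorMinor k) q.1 ξ.1 = A' at *
  generalize fderiv ℝ (spinorMajor k) q.1 ξ.1 = B' at *
  generalize fderiv ℝ halfIncCos q.1 ξ.1 = C' at *
  generalize fderiv ℝ halfIncSin q.1 ξ.1 = S' at *
  refine ⟨A', B', C' * S - S' * C, by linarith, r2, ?_, ?_⟩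
  · linear_combination r4 + 4 * q.1 1 * (C * C') * hCS + q.1 1 * (2 - 4 * C ^ 2) * r3
  · have huniq := hsec.unique ((hz.mul hframe).prodMk (hw.mul hframe))
    rw [huniq]
    simp only [Pi.mul_apply, hq0, ← hA, ← hB, ← hC, ← hS, ← hc, ← hs]
    refine Prod.ext ?_ ?_
    · refine Eq.trans ?_ (mul_frame_add _ _ _ _ _ _ _ _ _ hCS)
      dsimp only
      congr 3 <;> ring
    · refine Eq.trans ?_ (mul_frame_add _ _ _ _ _ _ _ _ _ hCS)
      rw [orbitFrame, ← hC, ← hS]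
      dsimp only
      congr 3 <;> ring

/-- The canonical form on two tangent vectors of the section. The pair of the planar spinor and its
momentum contributes `d𝓛 ∧ dδ`, and the rotation of the orbital frame the other two terms. -/
theorem canonicalForm_frame (k A B C S c s G : ℝ) (hcs : c ^ 2 + s ^ 2 = 1)
    (hG : k * (A * B) = G)
    {A₁ B₁ ν₁ A₂ B₂ ν₂ : ℝ} {ξ₁ ξ₂ : (Fin 3 → ℝ) × (Fin 3 → ℝ)}
    (h₁0 : k * (A * A₁ + B * B₁) = ξ₁.1 0) (h₁1 : k * (A₁ * B + A * B₁) = ξ₁.1 1)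
    (h₁2 : ξ₁.1 1 * (C ^ 2 - S ^ 2) + 4 * G * C * S * ν₁ = ξ₁.1 2)
    (h₂0 : k * (A * A₂ + B * B₂) = ξ₂.1 0) (h₂1 : k * (A₂ * B + A * B₂) = ξ₂.1 1)
    (h₂2 : ξ₂.1 1 * (C ^ 2 - S ^ 2) + 4 * G * C * S * ν₂ = ξ₂.1 2) :
    canonicalForm
      (quat (A₁ * c - A * s * (ξ₁.2 0 / 2)) 0 0 (-(B₁ * s + B * c * (ξ₁.2 0 / 2))) +
        quat (A * c) 0 0 (-(B * s)) *
          quat 0 ν₁ (-(ξ₁.2 2 * C * S)) (-((ξ₁.2 1 + ξ₁.2 2 * (C ^ 2 - S ^ 2)) / 2)),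
      quat (-(2 * k * (A₁ * s + A * c * (ξ₁.2 0 / 2)))) 0 0
          (-(2 * k * (B₁ * c - B * s * (ξ₁.2 0 / 2)))) +
        quat (-(2 * k * A * s)) 0 0 (-(2 * k * B * c)) *
          quat 0 ν₁ (-(ξ₁.2 2 * C * S)) (-((ξ₁.2 1 + ξ₁.2 2 * (C ^ 2 - S ^ 2)) / 2)))
      (quat (A₂ * c - A * s * (ξ₂.2 0 / 2)) 0 0 (-(B₂ * s + B * c * (ξ₂.2 0 / 2))) +
        quat (A * c) 0 0 (-(B * s)) *
          quat 0 ν₂ (-(ξ₂.2 2 * C * S)) (-((ξ₂.2 1 + ξ₂.2 2 * (C ^ 2 - S ^ 2)) / 2)),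
      quat (-(2 * k * (A₂ * s + A * c * (ξ₂.2 0 / 2)))) 0 0
          (-(2 * k * (B₂ * c - B * s * (ξ₂.2 0 / 2)))) +
        quat (-(2 * k * A * s)) 0 0 (-(2 * k * B * c)) *
          quat 0 ν₂ (-(ξ₂.2 2 * C * S)) (-((ξ₂.2 1 + ξ₂.2 2 * (C ^ 2 - S ^ 2)) / 2)))
      = ∑ i : Fin 3, (ξ₁.1 i * ξ₂.2 i - ξ₂.1 i * ξ₁.2 i) := by
  have hs2 : s ^ 2 = 1 - c ^ 2 := by linarith
  rw [Fin.sum_univ_three, ← h₁2, ← h₂2, ← h₁1, ← h₂1, ← h₁0, ← h₂0, ← hG]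
  generalize ξ₁.2 0 = x₀
  generalize ξ₁.2 1 = x₁
  generalize ξ₁.2 2 = x₂
  generalize ξ₂.2 0 = y₀
  generalize ξ₂.2 1 = y₁
  generalize ξ₂.2 2 = y₂
  simp only [canonicalForm]
  simp
  ring_nf
  simp only [hs2]
  ring

/-- The section pulls the canonical form back to `d𝓛 ∧ dδ + d𝓖 ∧ dγ + d𝓗 ∧ dζ`. -/
theorem canonicalForm_fderiv_actionAngleSection {k : ℝ} (hk : 0 < k)
    {q : (Fin 3 → ℝ) × (Fin 3 → ℝ)} (hq : q.1 ∈ actionDomain)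
    (ξ₁ ξ₂ : (Fin 3 → ℝ) × (Fin 3 → ℝ)) :
    canonicalForm (fderiv ℝ (actionAngleSection k) q ξ₁) (fderiv ℝ (actionAngleSection k) q ξ₂)
      = ∑ i : Fin 3, (ξ₁.1 i * ξ₂.2 i - ξ₂.1 i * ξ₁.2 i) := by
  obtain ⟨A₁, B₁, ν₁, h₁0, h₁1, h₁2, hD₁⟩ :=
    exists_fderiv_actionAngleSection hk hq ξ₁ rfl rfl rfl rfl rfl rfl
  obtain ⟨A₂, B₂, ν₂, h₂0, h₂1, h₂2, hD₂⟩ :=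
    exists_fderiv_actionAngleSection hk hq ξ₂ rfl rfl rfl rfl rfl rfl
  have hp : ‖tilt (halfIncCos q.1) (halfIncSin q.1) * turnVertical (q.2 2)‖ = 1 := by
    rw [norm_mul, norm_tilt (halfInc_sq_add_sq hq), norm_turnVertical, one_mul]
  rw [hD₁, hD₂, canonicalForm_mul (norm_turnVertical _) hp]
  exact canonicalForm_frame k _ _ _ _ _ _ _ (Real.cos_sq_add_sin_sq _) (spinor_mul hk hq)
    h₁0 h₁1 h₁2 h₂0 h₂1 h₂2

/-! ### Smooth local representatives of the coordinates -/

/-- Near a point where the vector `(X, Y)` does not vanish, its polar angle has a smooth real-valued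
representative: the argument relative to the direction at that point. -/
theorem exists_contDiffOn_polarAngle {E : Type*} [NormedAddCommGroup E] [NormedSpace ℝ E]
    {V : Set E} (hV : IsOpen V) {X Y : E → ℝ} (hX : ContDiffOn ℝ ∞ X V) (hY : ContDiffOn ℝ ∞ Y V)
    {x : E} (hx : x ∈ V) (h0 : 0 < X x ^ 2 + Y x ^ 2) :
    ∃ N ⊆ V, IsOpen N ∧ x ∈ N ∧ ∃ θ : E → ℝ, ContDiffOn ℝ ∞ θ N ∧
      ∀ y ∈ N, polarAngle (X y) (Y y) = (θ y : Real.Angle) := by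
  obtain ⟨c, hc⟩ : ∃ c : ℂ, c = ⟨X x, Y x⟩ := ⟨_, rfl⟩
  have hnc : Complex.normSq c = X x ^ 2 + Y x ^ 2 := by rw [hc, Complex.normSq_mk]; ring
  have hc0 : c ≠ 0 := by rw [← Complex.normSq_pos, hnc]; exact h0
  set F : E → ℂ := fun y => ((X y : ℂ) + (Y y : ℂ) * Complex.I) * (starRingEnd ℂ) c with hF
  have hFs : ContDiffOn ℝ ∞ F V :=
    ((Complex.ofRealCLM.contDiff.comp_contDiffOn hX).add
      ((Complex.ofRealCLM.contDiff.comp_contDiffOn hY).mul contDiffOn_const)).mul contDiffOn_const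
  have hmk : ∀ y, (X y : ℂ) + (Y y : ℂ) * Complex.I = ⟨X y, Y y⟩ := fun y => by
    apply Complex.ext <;> simp
  refine ⟨V ∩ F ⁻¹' Complex.slitPlane, Set.inter_subset_left,
    hFs.continuousOn.isOpen_inter_preimage hV Complex.isOpen_slitPlane, ⟨hx, ?_⟩,
    fun y => (Complex.log (F y)).im + Complex.arg c, ?_, ?_⟩
  -- at the base point `F = |c|²` is positive
  · have : F x = ((X x ^ 2 + Y x ^ 2 : ℝ) : ℂ) := by
      rw [hF]; dsimp only
      rw [hmk, ← hc, Complex.mul_conj, hnc]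
    rw [Set.mem_preimage, this]
    exact Complex.ofReal_mem_slitPlane.mpr h0
  · refine ContDiffOn.add ?_ contDiffOn_const
    have hlog : ContDiffOn ℝ ∞ (fun y => Complex.log (F y)) (V ∩ F ⁻¹' Complex.slitPlane) :=
      fun y hy => ((Complex.contDiffAt_log hy.2).restrict_scalars ℝ).comp_contDiffWithinAt y
        ((hFs y hy.1).mono Set.inter_subset_left)
    exact Complex.imCLM.contDiff.comp_contDiffOn hlog
  · rintro y ⟨-, hy⟩
    have hFy : F y ≠ 0 := Complex.slitPlane_ne_zero hy
    have hprod : F y * c = ((X x ^ 2 + Y x ^ 2 : ℝ) : ℂ) * ⟨X y, Y y⟩ := by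
      rw [hF]; dsimp only
      rw [hmk, mul_assoc, mul_comm _ c, Complex.mul_conj, hnc, mul_comm]
    dsimp only
    rw [Complex.log_im, Real.Angle.coe_add, ← Complex.arg_mul_coe_angle hFy hc0, hprod,
      Complex.arg_real_mul _ h0, polarAngle]

section StateSmooth

variable {E : Type*} [NormedAddCommGroup E] [NormedSpace ℝ E] {s : Set E} {f g : E → Fin 3 → ℝ}

theorem contDiffOn_dotProduct (hf : ContDiffOn ℝ ∞ f s) (hg : ContDiffOn ℝ ∞ g s) :
    ContDiffOn ℝ ∞ (fun x => f x ⬝ᵥ g x) s := by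
  simp only [dotProduct]
  exact ContDiffOn.sum fun i _ => (contDiffOn_pi.mp hf i).mul (contDiffOn_pi.mp hg i)

theorem contDiffOn_crossProduct (hf : ContDiffOn ℝ ∞ f s) (hg : ContDiffOn ℝ ∞ g s) :
    ContDiffOn ℝ ∞ (fun x => crossProduct (f x) (g x)) s := by
  have hf' := contDiffOn_pi.mp hf
  have hg' := contDiffOn_pi.mp hg
  simp only [cross_apply]
  refine contDiffOn_pi.mpr fun i => ?_
  fin_cases i
  · exact ((hf' 1).mul (hg' 2)).sub ((hf' 2).mul (hg' 1))
  · exact ((hf' 2).mul (hg' 0)).sub ((hf' 0).mul (hg' 2))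
  · exact ((hf' 0).mul (hg' 1)).sub ((hf' 1).mul (hg' 0))

theorem contDiffOn_len (hf : ContDiffOn ℝ ∞ f s) (h : ∀ x ∈ s, f x ≠ 0) :
    ContDiffOn ℝ ∞ (fun x => len (f x)) s :=
  (contDiffOn_dotProduct hf hf).sqrt fun x hx => (dotProduct_self_pos (h x hx)).ne'

end StateSmooth

theorem contDiffOn_angMom (U : Set State) : ContDiffOn ℝ ∞ angMom U :=
  contDiffOn_crossProduct contDiffOn_fst contDiffOn_snd

theorem contDiffOn_nodeVec (U : Set State) : ContDiffOn ℝ ∞ nodeVec U :=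
  contDiffOn_crossProduct contDiffOn_const (contDiffOn_angMom U)

theorem contDiffOn_redAction (k : ℝ) : ContDiffOn ℝ ∞ (redAction k) {s | s.1 ≠ 0} := by
  have h : ContDiffOn ℝ ∞ (fun s : State => len s.2 ^ 2) {s | s.1 ≠ 0} := by
    simp only [len_sq]
    exact contDiffOn_dotProduct contDiffOn_snd contDiffOn_snd
  exact ((contDiffOn_len contDiffOn_fst fun _ hs => hs).mul (h.add contDiffOn_const)).div_const _

theorem contDiffOn_redEcc {k : ℝ} (hk : 0 < k) : ContDiffOn ℝ ∞ (redEcc k) {s | s.1 ≠ 0} := by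
  refine ContDiffOn.sub (ContDiffOn.smul (contDiffOn_const.div
    (contDiffOn_const.mul (contDiffOn_redAction k)) fun s hs => ?_)
    (contDiffOn_crossProduct contDiffOn_snd (contDiffOn_angMom _)))
    (ContDiffOn.smul (contDiffOn_const.div (contDiffOn_len contDiffOn_fst fun _ hs => hs)
      fun s hs => len_ne_zero hs) contDiffOn_fst)
  exact (mul_pos hk (redAction_pos hk hs)).ne'

theorem isOpen_goodStates {k : ℝ} (hk : 0 < k) : IsOpen (goodStates k) := by
  have hQ : IsOpen {s : State | s.1 ≠ 0} := isOpen_ne_fun continuous_fst continuous_const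
  have hC : IsOpen {s : State | angMom s ≠ 0} :=
    isOpen_ne_fun (contDiffOn_univ.mp (contDiffOn_angMom _)).continuous continuous_const
  have hn : IsOpen {s : State | nodeVec s ≠ 0} :=
    isOpen_ne_fun (contDiffOn_univ.mp (contDiffOn_nodeVec _)).continuous continuous_const
  have hE : IsOpen ({s : State | s.1 ≠ 0} ∩ redEcc k ⁻¹' {0}ᶜ) :=
    (contDiffOn_redEcc hk).continuousOn.isOpen_inter_preimage hQ isOpen_compl_singleton
  convert (hC.inter hn).inter hE using 1
  ext s
  constructor
  · rintro ⟨h1, h2, h3, h4⟩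
    exact ⟨⟨h2, h4⟩, h1, h3⟩
  · rintro ⟨⟨h2, h4⟩, h1, h3⟩
    exact ⟨h1, h2, h3, h4⟩

/-- The coordinates have smooth local representatives on the good states: the three planar vectors
whose polar angles are taken do not vanish there. -/
theorem exists_contDiffOn_stateCoords {k : ℝ} (hk : 0 < k) {s : State} (hs : s ∈ goodStates k) :
    ∃ N ⊆ goodStates k, IsOpen N ∧ s ∈ N ∧ ∃ A θ : State → Fin 3 → ℝ, ContDiffOn ℝ ∞ A N ∧
      ContDiffOn ℝ ∞ θ N ∧ ∀ y ∈ N, stateCoords k y = (A y, toAngles (θ y)) := by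
  have hopen := isOpen_goodStates hk
  have hsub : goodStates k ⊆ {s | s.1 ≠ 0} := fun y hy => hy.1
  have hact := (contDiffOn_redAction k).mono hsub
  have hecc := (contDiffOn_redEcc hk).mono hsub
  have hang := contDiffOn_angMom (goodStates k)
  have hnode := contDiffOn_nodeVec (goodStates k)
  have hlen : ContDiffOn ℝ ∞ (fun s : State => len s.1) (goodStates k) :=
    contDiffOn_len contDiffOn_fst fun y hy => hy.1
  have hlang : ContDiffOn ℝ ∞ (fun s : State => len (angMom s)) (goodStates k) :=
    contDiffOn_len hang fun y hy => hy.2.1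
  obtain ⟨h1, h2, -⟩ := stateCoords_fst_mem hk hs
  change 0 < len (angMom s) at h1
  change len (angMom s) < redAction k s at h2
  have hn := nodeVec_sq_pos hs.2.2.2
  obtain ⟨N₀, hN₀, ho₀, hs₀, θ₀, hθ₀, he₀⟩ := exists_contDiffOn_polarAngle hopen
    (hact.sub (contDiffOn_const.mul hlen)) (contDiffOn_dotProduct contDiffOn_fst contDiffOn_snd) hs
    (by rw [eccAnomaly_sq hk]; nlinarith)
  obtain ⟨N₁, hN₁, ho₁, hs₁, θ₁, hθ₁, he₁⟩ := exists_contDiffOn_polarAngle hopen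
    (hlang.mul (contDiffOn_dotProduct hnode hecc))
    (contDiffOn_dotProduct (contDiffOn_crossProduct hang hnode) hecc) hs
    (by rw [delg_sq s (redEcc_dot_angMom k s)]
        have := len_pos hs.2.2.1
        positivity)
  obtain ⟨N₂, hN₂, ho₂, hs₂, θ₂, hθ₂, he₂⟩ := exists_contDiffOn_polarAngle hopen
    (contDiffOn_pi.mp hnode 0) (contDiffOn_pi.mp hnode 1) hs (by rw [nodeVec_sq]; exact hn)
  refine ⟨N₀ ∩ (N₁ ∩ N₂), fun y hy => hN₀ hy.1, ho₀.inter (ho₁.inter ho₂), ⟨hs₀, hs₁, hs₂⟩,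
    fun y => ![redAction k y, len (angMom y), angMom y 2], fun y => ![θ₀ y, θ₁ y, θ₂ y], ?_, ?_, ?_⟩
  · have hsub : N₀ ∩ (N₁ ∩ N₂) ⊆ goodStates k := fun y hy => hN₀ hy.1
    refine contDiffOn_pi.mpr fun i => ?_
    fin_cases i
    · exact hact.mono hsub
    · exact hlang.mono hsub
    · exact (contDiffOn_pi.mp hang 2).mono hsub
  · refine contDiffOn_pi.mpr fun i => ?_
    fin_cases i
    · exact hθ₀.mono fun y hy => hy.1
    · exact hθ₁.mono fun y hy => hy.2.1
    · exact hθ₂.mono fun y hy => hy.2.2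
  · rintro y ⟨hy₀, hy₁, hy₂⟩
    refine Prod.ext rfl ?_
    ext i
    fin_cases i
    · exact he₀ y hy₀
    · exact he₁ y hy₁
    · exact he₂ y hy₂

/-! ### Darboux coordinates -/

/-- A curve in the cone `BL = 0` has tangent vectors tangent to the cone. -/
theorem mem_tangentSigma_of_hasDerivAt {c : ℝ → Quaternion ℝ × Quaternion ℝ}
    {v : Quaternion ℝ × Quaternion ℝ} {t : ℝ} (hc : HasDerivAt c v t) (h : ∀ τ, BL (c τ) = 0) :
    v ∈ tangentSigma (c t) := by
  have h1 : HasDerivAt (fun τ => (c τ).1) v.1 t := hc.fst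
  have h2 : HasDerivAt (fun τ => (c τ).2) v.2 t := hc.snd
  have h3 := reL.hasFDerivAt.comp_hasDerivAt t
    (((starL.hasFDerivAt.comp_hasDerivAt t h1).mul_const qi).mul h2)
  have h4 : HasDerivAt (fun τ => BL (c τ)) 0 t := by
    simp only [h]
    exact hasDerivAt_const _ _
  exact h3.unique h4

theorem fderiv_actionAngleSection_mem {k : ℝ} {q : (Fin 3 → ℝ) × (Fin 3 → ℝ)}
    (hq : q.1 ∈ actionDomain) (ξ : (Fin 3 → ℝ) × (Fin 3 → ℝ)) :
    fderiv ℝ (actionAngleSection k) q ξ ∈ tangentSigma (actionAngleSection k q) := by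
  have hline : HasDerivAt (fun τ : ℝ => q + τ • ξ) ξ 0 := by
    simpa using ((hasDerivAt_id (0 : ℝ)).smul_const ξ).const_add q
  have hsec := ((contDiffOn_actionAngleSection (k := k)).contDiffAt
      (isOpen_fst_mem_actionDomain.mem_nhds hq)).differentiableAt
      (by simp) |>.hasFDerivAt.comp_hasDerivAt_of_eq (0 : ℝ) hline (by simp)
  simpa using mem_tangentSigma_of_hasDerivAt hsec fun τ => BL_actionAngleSection k _

/-- Local representatives of the coordinates satisfy `ω₁ = ∑ dA ∧ dθ`: composed with the section
they give back the state, and both the section and the Kustaanheimo-Stiefel map preserve the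
symplectic forms. -/
theorem canonicalForm_eq_of_representatives {k : ℝ} (hk : 0 < k) {N : Set State} (hN : IsOpen N)
    (hNs : N ⊆ goodStates k) {A θ : State → Fin 3 → ℝ} (hA : ContDiffOn ℝ ∞ A N)
    (hθ : ContDiffOn ℝ ∞ θ N) (hc : ∀ s ∈ N, stateCoords k s = (A s, toAngles (θ s)))
    {y : Quaternion ℝ × Quaternion ℝ} (hBL : BL y = 0) (hy : KS y ∈ N)
    {v v' : Quaternion ℝ × Quaternion ℝ} (hv : v ∈ tangentSigma y) (hv' : v' ∈ tangentSigma y) :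
    canonicalForm v v' = ∑ i : Fin 3,
      (fderiv ℝ (fun x => A (KS x)) y v i * fderiv ℝ (fun x => θ (KS x)) y v' i -
        fderiv ℝ (fun x => A (KS x)) y v' i * fderiv ℝ (fun x => θ (KS x)) y v i) := by
  have hy0 : y.1 ≠ 0 := fun h => (hNs hy).1 (KS_fst_eq_zero_iff.mpr h)
  have hKS := (contDiffOn_KS.contDiffAt (isOpen_fst_ne_zero.mem_nhds hy0)).differentiableAt
    (by simp)
  have hA' : DifferentiableAt ℝ (fun x => A (KS x)) y :=
    ((hA.contDiffAt (hN.mem_nhds hy)).differentiableAt (by simp)).comp y hKS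
  have hθ' : DifferentiableAt ℝ (fun x => θ (KS x)) y :=
    ((hθ.contDiffAt (hN.mem_nhds hy)).differentiableAt (by simp)).comp y hKS
  have hmem : ∀ s ∈ N, (A s, θ s).1 ∈ actionDomain := fun s hs => by
    have := stateCoords_fst_mem hk (hNs hs)
    rwa [hc s hs] at this
  have hF := hA'.hasFDerivAt.prodMk hθ'.hasFDerivAt
  set q := (A (KS y), θ (KS y)) with hq
  have hqm : q.1 ∈ actionDomain := hmem _ hy
  have hσ := (((contDiffOn_actionAngleSection (k := k)).contDiffAt
      (isOpen_fst_mem_actionDomain.mem_nhds hqm)).differentiableAt (by simp)).hasFDerivAt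
  have hz := actionAngleSection_fst_ne_zero hk hqm
  have hKSσ := ((contDiffOn_KS.contDiffAt (isOpen_fst_ne_zero.mem_nhds hz)).differentiableAt
    (by simp)).hasFDerivAt
  have hcomp := hKSσ.comp y (hσ.comp y hF)
  have hback : ∀ᶠ x in nhds y, KS x = KS (actionAngleSection k (A (KS x), θ (KS x))) := by
    filter_upwards [hKS.continuousAt.eventually (hN.mem_nhds hy)] with x hx
    obtain ⟨h1, h2⟩ := stateCoords_actionAngleSection hk (hmem _ hx)
    exact stateCoords_injOn hk (hNs hx) h1 (by rw [h2, hc _ hx])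
  have huniq := hKS.hasFDerivAt.unique (hcomp.congr_of_eventuallyEq hback)
  have hKSeq : ∀ u, fderiv ℝ KS y u = fderiv ℝ KS (actionAngleSection k q)
      (fderiv ℝ (actionAngleSection k) q
        (fderiv ℝ (fun x => A (KS x)) y u, fderiv ℝ (fun x => θ (KS x)) y u)) := fun u => by
    rw [huniq]; rfl
  rw [canonicalForm_eq_KS hy0 hBL hv hv', hKSeq v, hKSeq v',
    ← canonicalForm_eq_KS hz (BL_actionAngleSection k q) (fderiv_actionAngleSection_mem hqm _)
      (fderiv_actionAngleSection_mem hqm _), canonicalForm_fderiv_actionAngleSection hk hqm]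

theorem isQuotientMap_proj : Topology.IsQuotientMap proj := isQuotientMap_quotient_mk'

theorem continuous_proj : Continuous proj := isQuotientMap_proj.continuous

theorem isOpenMap_toAngles : IsOpenMap toAngles :=
  IsOpenMap.piMap (f := fun _ : Fin 3 => ((↑) : ℝ → Real.Angle))
    (fun _ => QuotientAddGroup.isOpenMap_coe)
    (Filter.Eventually.of_forall fun _ => QuotientAddGroup.mk_surjective)

theorem toAngles_surjective : Function.Surjective toAngles := fun φ =>
  ⟨fun i => (φ i).toReal, funext fun i => (φ i).coe_toReal⟩

theorem continuous_toAngles : Continuous toAngles :=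
  continuous_pi fun i => Real.Angle.continuous_coe.comp (continuous_apply i)

/-- A map with smooth local representatives is continuous. -/
theorem IsSymplecticOn.continuousOn {U : Set VZero} (hU : IsOpen U)
    {Φ : VZero → (Fin 3 → ℝ) × (Fin 3 → Real.Angle)} (h : IsSymplecticOn U Φ) :
    ContinuousOn Φ U := by
  rw [isQuotientMap_proj.continuousOn_isOpen_iff hU]
  intro x hx
  obtain ⟨N, hN, hxN, A, θ, hA, hθ, hΦ, -⟩ := h x hx
  have hval := (continuous_subtype_val (p := (· ∈ SigmaZero))).continuousAt (x := x)
  have hA' : ContinuousAt (fun y : SigmaZero => A y.1) x :=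
    ContinuousAt.comp (hA.continuousOn.continuousAt (hN.mem_nhds hxN)) hval
  have hθ' : ContinuousAt (fun y : SigmaZero => θ y.1) x :=
    ContinuousAt.comp (hθ.continuousOn.continuousAt (hN.mem_nhds hxN)) hval
  refine ContinuousAt.continuousWithinAt ?_
  refine (hA'.prodMk (continuous_toAngles.continuousAt.comp hθ')).congr ?_
  filter_upwards [hval.eventually (hN.mem_nhds hxN)] with y hy
  exact (hΦ y hy).symm

/-- An injective map with smooth local inverses is open. -/
theorem HasSmoothInverseOn.isOpenMap {U : Set VZero}
    {Φ : VZero → (Fin 3 → ℝ) × (Fin 3 → Real.Angle)} (h : HasSmoothInverseOn U Φ)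
    (hinj : Set.InjOn Φ U) : IsOpenMap (U.domRestrict Φ) := by
  intro O hO
  obtain ⟨O', hO', rfl⟩ := isOpen_induced_iff.mp hO
  rw [isOpen_iff_mem_nhds]
  rintro _ ⟨⟨p, hp⟩, hpO, rfl⟩
  change p ∈ O' at hpO
  change _ ∈ nhds (Φ p)
  obtain ⟨t, ht⟩ := toAngles_surjective (Φ p).2
  have hΦp : Φ p = ((Φ p).1, toAngles t) := by rw [ht]
  obtain ⟨W, hW, hmem, σ, hσ, hinv⟩ := h (Φ p).1 t (by rw [← hΦp]; exact Set.mem_image_of_mem _ hp)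
  have hg : Continuous fun q : W => proj ⟨σ q, (hinv q q.2).1⟩ :=
    continuous_proj.comp (Continuous.subtype_mk hσ.continuousOn.domRestrict _)
  have hopen := (IsOpenMap.id.prodMap isOpenMap_toAngles) _
    (hW.isOpenMap_subtype_val _ (hO'.preimage hg))
  refine Filter.mem_of_superset (hopen.mem_nhds ?_) ?_
  · refine ⟨((Φ p).1, t), ⟨⟨_, hmem⟩, ?_, rfl⟩, hΦp.symm⟩
    obtain ⟨h1, h2, h3⟩ := hinv _ hmem
    have := hinj h2 hp (h3.trans hΦp.symm)
    rw [Set.mem_preimage, this]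
    exact hpO
  · rintro _ ⟨_, ⟨⟨q, hq⟩, hqO, rfl⟩, rfl⟩
    obtain ⟨h1, h2, h3⟩ := hinv q hq
    exact ⟨⟨_, h2⟩, hqO, h3⟩

end LCF

end

theorem mainTheorem3 (μ₀ M₀ f : ℝ) (hμ : 0 < μ₀) (hM : 0 < M₀) (hf : 0 < f) :
    LCF.IsDarbouxCoordinates (LCF.VTilde μ₀ M₀ f) (LCF.coords μ₀ M₀ f) := by
  obtain ⟨k, hkdef⟩ : ∃ k, k = √(2 * μ₀ * f) := ⟨_, rfl⟩
  have hk : 0 < k := by rw [hkdef]; exact Real.sqrt_pos.mpr (by positivity)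
  have hmem : ∀ p, p ∈ LCF.VTilde μ₀ M₀ f ↔ p.state ∈ LCF.goodStates k := by
    rw [hkdef]; exact LCF.mem_VTilde_iff hμ hf
  have hcoords : ∀ p : LCF.VZero, p.state ∈ LCF.goodStates k →
      LCF.coords μ₀ M₀ f p = LCF.stateCoords k p.state := fun p hp => by
    rw [hkdef]; exact LCF.coords_eq hμ hM hf hp.1
  have hpre : IsOpen ({x | x.1 ≠ 0} ∩ LCF.KS ⁻¹' LCF.goodStates k) :=
    LCF.contDiffOn_KS.continuousOn.isOpen_inter_preimage LCF.isOpen_fst_ne_zero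
      (LCF.isOpen_goodStates hk)
  have hopen : IsOpen (LCF.VTilde μ₀ M₀ f) := by
    rw [← LCF.isQuotientMap_proj.isOpen_preimage]
    convert hpre.preimage (continuous_subtype_val (p := (· ∈ LCF.SigmaZero))) using 1
    ext x
    refine (hmem _).trans ⟨fun h => ⟨fun h0 => ?_, h⟩, fun h => h.2⟩
    exact h.1 (LCF.KS_fst_eq_zero_iff.mpr h0)
  have hinj : Set.InjOn (LCF.coords μ₀ M₀ f) (LCF.VTilde μ₀ M₀ f) := by
    intro p hp p' hp' h
    rw [hmem] at hp hp'
    rw [hcoords p hp, hcoords p' hp'] at h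
    have hstate := LCF.stateCoords_injOn hk hp hp' h
    obtain ⟨x, rfl⟩ := LCF.isQuotientMap_proj.surjective p
    obtain ⟨x', rfl⟩ := LCF.isQuotientMap_proj.surjective p'
    exact LCF.proj_eq_of_KS_eq (fun h0 => hp.1 (LCF.KS_fst_eq_zero_iff.mpr h0)) hstate
  have hsymp : LCF.IsSymplecticOn (LCF.VTilde μ₀ M₀ f) (LCF.coords μ₀ M₀ f) := by
    intro x hx
    have hxs : LCF.KS x.1 ∈ LCF.goodStates k := (hmem _).mp hx
    obtain ⟨N, hNs, hN, hxN, A, θ, hA, hθ, hc⟩ := LCF.exists_contDiffOn_stateCoords hk hxs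
    have hKS := LCF.contDiffOn_KS.mono
      (Set.inter_subset_left (s := {x | x.1 ≠ 0}) (t := LCF.KS ⁻¹' N))
    refine ⟨{x | x.1 ≠ 0} ∩ LCF.KS ⁻¹' N,
      LCF.contDiffOn_KS.continuousOn.isOpen_inter_preimage LCF.isOpen_fst_ne_zero hN,
      ⟨fun h0 => hxs.1 (LCF.KS_fst_eq_zero_iff.mpr h0), hxN⟩,
      fun y => A (LCF.KS y), fun y => θ (LCF.KS y), hA.comp hKS fun y hy => hy.2,
      hθ.comp hKS fun y hy => hy.2, fun y hy => ?_, fun y hy v hv v' hv' => ?_⟩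
    · exact (hcoords (LCF.proj y) (hNs hy.2)).trans (hc _ hy.2)
    · exact LCF.canonicalForm_eq_of_representatives hk hN hNs hA hθ hc y.2.1 hy.2 hv hv'
  have hsmooth : LCF.HasSmoothInverseOn (LCF.VTilde μ₀ M₀ f) (LCF.coords μ₀ M₀ f) := by
    rintro a t ⟨p, hp, hpa⟩
    rw [hmem] at hp
    have ha : a ∈ LCF.actionDomain := by
      have := LCF.stateCoords_fst_mem hk hp
      rwa [← hcoords p hp, hpa] at this
    refine ⟨{q | q.1 ∈ LCF.actionDomain}, LCF.isOpen_fst_mem_actionDomain, ha,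
      LCF.actionAngleSection k, LCF.contDiffOn_actionAngleSection, fun q hq => ?_⟩
    obtain ⟨h1, h2⟩ := LCF.stateCoords_actionAngleSection hk hq
    exact ⟨LCF.actionAngleSection_mem hk hq, (hmem _).mpr h1,
      (hcoords (LCF.proj ⟨_, _⟩) h1).trans h2⟩
  exact ⟨hopen, Topology.IsOpenEmbedding.of_continuous_injective_isOpenMap
    (continuousOn_iff_continuous_domRestrict.mp (hsymp.continuousOn hopen))
    (Set.injOn_iff_injective.mp hinj) (hsmooth.isOpenMap hinj), hsymp, hsmooth⟩
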